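/- Let $d\in\{2,3\}$ and let $\Omega\subset\mathbb R^d$ be a bounded open set (for instance a bounded Lipschitz domain). Let $\mathcal V$ be the space of smooth, compactly supported, divergence-free vector fields on $\Omega$, let $H$ and $V$ be the closures of $\mathcal V$ in $L^2(\Omega)^d$ and in $H^1_0(\Omega)^d$, with $\|u\|_H=\|u\|_{L^2(\Omega)}$ and $\|u\|_V=\|\nabla u\|_{L^2(\Omega)}$, and let $V'$ be the dual of $V$, with $\|f\|_{V'}=\sup\{|\langle f,v\rangle|:\ v\in V,\ \|v\|_V\le 1\}$. Put $a(u,v)=\int_\Omega\nabla u:\nabla v\,dx$ and $b(u,v,w)=\int_\Omega ((u\cdot\nabla)v)\cdot w\,dx$. Let $\nu\in L^1(0,T)$ for every $T>0$, with $0<\underline\nu\le\nu(t)\le\overline\nu<\infty$ for all $t>0$; let $f\in L^2(0,T;V')$ for every $T>0$, and let $u_0\in H$. Let $u$ be a weak solution on $[0,\infty)$ of the Navier–Stokes equations on $\Omega$ with no-slip boundary condition, viscosity $\nu(t)$, force $f$ and initial value $u_0$. That is: $u\colon[0,\infty)\to H$ is weakly continuous; $u\in L^2(0,T;V)$ for every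 $T>0$; the distributional time derivative satisfies $du/dt\in L^1(\varepsilon,T;V')$ whenever $0<\varepsilon<T$; $u(0)=u_0$; and for almost every $t>0$ $$\Big\langle \frac{du}{dt}(t),v\Big\rangle+\nu(t)\,a(u(t),v)+b(u(t),u(t),v)=\langle f(t),v\rangle\qquad\text{for all } v\in V .$$ If $d=3$, weak solutions are moreover understood in the sense of Leray and Hopf: for almost every $s>0$ and for all $t\ge s$, $$\tfrac12\|u(t)\|_H^2+\int_s^t\nu(\tau)\|u(\tau)\|_V^2\,d\tau\le\tfrac12\|u(s)\|_H^2+\int_s^t\langle f(\tau),u(\tau)\rangle\,d\tau .$$ Then $$\limsup_{t\to\infty}\|u(t)\|_H^2\ \le\ \frac{\bar K}{\underline\nu}\,\limsup_{t\to\infty}\|f(t)\|_{V'}^2,\qquad \bar K=\limsup_{t\to\infty}\int_0^t\exp\Big(-\frac1{c_\rho^2}\int_s^t\nu(z)\,dz\Big)ds,$$ where $c_\rho$ is the best Poincaré constant, that is, the least $c\ge0$ with $\|v\|_H\le c\,\|v\|_V$ for all $v\in V$, and where the limsup of $\|f(t)\|_{V'}^2$ is the essential one ($f$ being defined for almost every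 $t$); both sides are read in $[0,\infty]$. -/

import Mathlib

open MeasureTheory Filter Topology Set
open scoped ENNReal ContDiff

noncomputable section

namespace NSE

/-- Points of `ℝ^d` and values of velocity fields, with the Euclidean norm. -/
abbrev E (d : ℕ) : Type := EuclideanSpace ℝ (Fin d)

/-- `d × d` matrices with the Frobenius (Euclidean) norm; the entry `(i, j)` of a velocity
gradient is `∂_j u_i`. -/
abbrev M (d : ℕ) : Type := EuclideanSpace ℝ (Fin d × Fin d)

/-- The vector-valued space `L²(Ω)^d`. -/
abbrev L2Vec {d : ℕ} (Ω : Set (E d)) : Type := Lp (E d) 2 (volume.restrict Ω)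

/-- The matrix-valued space `L²(Ω)^{d × d}`. -/
abbrev L2Mat {d : ℕ} (Ω : Set (E d)) : Type := Lp (M d) 2 (volume.restrict Ω)

/-- The classical partial derivative `∂_j φ_i (x)`. -/
def partialDeriv {d : ℕ} (φ : E d → E d) (i j : Fin d) (x : E d) : ℝ :=
  fderiv ℝ φ x (EuclideanSpace.single j 1) i

/-- The classical gradient of a vector field. -/
def gradField {d : ℕ} (φ : E d → E d) (x : E d) : M d :=
  WithLp.toLp 2 fun p => partialDeriv φ p.1 p.2 x

/-- The space `𝒱` of smooth, compactly supported, divergence-free vector fields on `Ω`. -/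
def IsTestField {d : ℕ} (Ω : Set (E d)) (φ : E d → E d) : Prop :=
  ContDiff ℝ ∞ φ ∧ HasCompactSupport φ ∧ tsupport φ ⊆ Ω ∧ ∀ x, ∑ i, partialDeriv φ i i x = 0

theorem partialDeriv_add {d : ℕ} {φ ψ : E d → E d} (hφ : ContDiff ℝ ∞ φ) (hψ : ContDiff ℝ ∞ ψ)
    (i j : Fin d) (x : E d) :
    partialDeriv (φ + ψ) i j x = partialDeriv φ i j x + partialDeriv ψ i j x := by
  have h1 := (hφ.differentiable (by simp)) x
  have h2 := (hψ.differentiable (by simp)) x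
  simp [partialDeriv, fderiv_add h1 h2]

theorem partialDeriv_smul {d : ℕ} {φ : E d → E d} (hφ : ContDiff ℝ ∞ φ) (c : ℝ)
    (i j : Fin d) (x : E d) :
    partialDeriv (c • φ) i j x = c * partialDeriv φ i j x := by
  have h1 := (hφ.differentiable (by simp)) x
  simp [partialDeriv, fderiv_const_smul h1 c]

theorem isTestField_zero {d : ℕ} (Ω : Set (E d)) : IsTestField Ω (0 : E d → E d) := by
  refine ⟨contDiff_const, HasCompactSupport.zero, by simp [tsupport], fun x => ?_⟩
  simp [partialDeriv]

theorem IsTestField.add {d : ℕ} {Ω : Set (E d)} {φ ψ : E d → E d}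
    (hφ : IsTestField Ω φ) (hψ : IsTestField Ω ψ) : IsTestField Ω (φ + ψ) := by
  refine ⟨hφ.1.add hψ.1, hφ.2.1.add hψ.2.1, ?_, fun x => ?_⟩
  · exact (tsupport_add φ ψ).trans (union_subset hφ.2.2.1 hψ.2.2.1)
  · simp only [partialDeriv_add hφ.1 hψ.1, Finset.sum_add_distrib, hφ.2.2.2 x, hψ.2.2.2 x,
      add_zero]

theorem IsTestField.smul {d : ℕ} {Ω : Set (E d)} {φ : E d → E d}
    (hφ : IsTestField Ω φ) (c : ℝ) : IsTestField Ω (c • φ) := by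
  refine ⟨contDiff_const.smul hφ.1, hφ.2.1.smul_left (f := fun _ => c), ?_, fun x => ?_⟩
  · exact (tsupport_smul_subset_right (fun _ => c) φ).trans hφ.2.2.1
  · simp only [partialDeriv_smul hφ.1, ← Finset.mul_sum, hφ.2.2.2 x, mul_zero]

/-- `𝒱` as a subspace of `L²(Ω)^d`. -/
def testL2 {d : ℕ} (Ω : Set (E d)) : Submodule ℝ (L2Vec Ω) where
  carrier := {h | ∃ φ, IsTestField Ω φ ∧ h =ᵐ[volume.restrict Ω] φ}
  zero_mem' := ⟨0, isTestField_zero Ω, Lp.coeFn_zero _ _ _⟩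
  add_mem' := by
    rintro a b ⟨φ, hφ, ha⟩ ⟨ψ, hψ, hb⟩
    exact ⟨φ + ψ, hφ.add hψ, (Lp.coeFn_add a b).trans (ha.add hb)⟩
  smul_mem' := by
    rintro c a ⟨φ, hφ, ha⟩
    exact ⟨c • φ, hφ.smul c, (Lp.coeFn_smul c a).trans (ha.const_smul c)⟩

/-- `H`, the closure of `𝒱` in `L²(Ω)^d`, with the `L²` norm. -/
abbrev H {d : ℕ} (Ω : Set (E d)) : Submodule ℝ (L2Vec Ω) := (testL2 Ω).topologicalClosure

/-- `𝒱` inside `H¹(Ω)^d`, where an element `u` of `H¹` is represented by the pair `(u, ∇u)` in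
`L² × L²`; the norm of the pair is `(‖u‖² + ‖∇u‖²)^{1/2}`. -/
def testH1 {d : ℕ} (Ω : Set (E d)) : Submodule ℝ (WithLp 2 (L2Vec Ω × L2Mat Ω)) where
  carrier := {p | ∃ φ, IsTestField Ω φ ∧ p.fst =ᵐ[volume.restrict Ω] φ ∧
    p.snd =ᵐ[volume.restrict Ω] gradField φ}
  zero_mem' := by
    refine ⟨0, isTestField_zero Ω, Lp.coeFn_zero _ _ _, ?_⟩
    filter_upwards [Lp.coeFn_zero (M d) 2 (volume.restrict Ω)] with x hx
    refine hx.trans ?_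
    ext p
    simp [gradField, partialDeriv]
  add_mem' := by
    rintro a b ⟨φ, hφ, ha, ha'⟩ ⟨ψ, hψ, hb, hb'⟩
    refine ⟨φ + ψ, hφ.add hψ, (Lp.coeFn_add a.fst b.fst).trans (ha.add hb), ?_⟩
    filter_upwards [Lp.coeFn_add a.snd b.snd, ha', hb'] with x hx h1 h2
    refine hx.trans ?_
    ext p
    simp [h1, h2, gradField, partialDeriv_add hφ.1 hψ.1]
  smul_mem' := by
    rintro c a ⟨φ, hφ, ha, ha'⟩
    refine ⟨c • φ, hφ.smul c, (Lp.coeFn_smul c a.fst).trans (ha.const_smul c), ?_⟩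
    filter_upwards [Lp.coeFn_smul c a.snd, ha'] with x hx h1
    refine hx.trans ?_
    ext p
    simp [h1, gradField, partialDeriv_smul hφ.1]

/-- `V`, the closure of `𝒱` in `H¹(Ω)^d`. Its elements are the pairs `(v, ∇v)`. The norm that this
type carries is the full `H¹` norm and only serves to speak of its topology; the norm
`‖v‖_V = |v|_{H¹}` is always written out as `‖grad v‖`. -/
def V {d : ℕ} (Ω : Set (E d)) : Type := (testH1 Ω).topologicalClosure

instance {d : ℕ} (Ω : Set (E d)) : NormedAddCommGroup (V Ω) :=
  inferInstanceAs (NormedAddCommGroup (testH1 Ω).topologicalClosure)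

instance {d : ℕ} (Ω : Set (E d)) : InnerProductSpace ℝ (V Ω) :=
  inferInstanceAs (InnerProductSpace ℝ (testH1 Ω).topologicalClosure)

/-- The element of `L²(Ω)^d` underlying an element of `V`. -/
def field {d : ℕ} {Ω : Set (E d)} (v : V Ω) : L2Vec Ω := (Subtype.val v).fst

/-- The (weak) gradient of an element of `V`. -/
def grad {d : ℕ} {Ω : Set (E d)} (v : V Ω) : L2Mat Ω := (Subtype.val v).snd

/-- `V'`, the continuous linear functionals on `V`. -/
abbrev V' {d : ℕ} (Ω : Set (E d)) : Type := V Ω →L[ℝ] ℝ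

/-- The norm `‖f‖_{V'} = sup { |⟨f, v⟩| : v ∈ V, ‖v‖_V ≤ 1 }`, where `‖v‖_V = ‖∇v‖_{L²}`. -/
def dualNorm {d : ℕ} {Ω : Set (E d)} (f : V' Ω) : ℝ≥0∞ :=
  ⨆ (v : V Ω) (_ : ‖grad v‖ ≤ 1), ‖f v‖ₑ

/-- The Dirichlet form `a(u,v) = (∇u, ∇v)_{L²}`. -/
def formA {d : ℕ} {Ω : Set (E d)} (u v : V Ω) : ℝ := inner ℝ (grad u) (grad v)

/-- The trilinear form `b(u,v,w) = ∫_Ω ((u · ∇) v) · w = ∫_Ω ∑_{i,j} u_j ∂_j v_i w_i`. -/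
def formB {d : ℕ} {Ω : Set (E d)} (u v w : V Ω) : ℝ :=
  ∫ x in Ω, ∑ i, ∑ j, field u x j * grad v x (i, j) * field w x i

/-- The best Poincaré constant: the least `c ≥ 0` with `‖v‖_H ≤ c ‖v‖_V` for all `v ∈ V`. -/
def poincareConst {d : ℕ} (Ω : Set (E d)) : ℝ :=
  sInf {c : ℝ | 0 ≤ c ∧ ∀ v : V Ω, ‖field v‖ ≤ c * ‖grad v‖}

/-- `g` is the distributional time derivative on `(0, ∞)` of the `H`-valued function `u`, in the
Gelfand triple `V ⊂ H = H' ⊂ V'`. -/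
def IsTimeDeriv {d : ℕ} {Ω : Set (E d)} (u : ℝ → H Ω) (g : ℝ → V' Ω) : Prop :=
  ∀ θ : ℝ → ℝ, ContDiff ℝ ∞ θ → HasCompactSupport θ → tsupport θ ⊆ Ioi 0 → ∀ v : V Ω,
    ∫ t in Ioi (0 : ℝ), deriv θ t * inner ℝ (u t : L2Vec Ω) (field v) =
      - ∫ t in Ioi (0 : ℝ), θ t * g t v

/-- The defining properties of a weak solution `u` on `[0, ∞)` of the Navier-Stokes equations on
`Ω` with no-slip boundary condition, viscosity `ν`, force `f` and initial value `u₀`, where `U` is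
`u` seen as an (almost everywhere defined) `V`-valued function and `g = du/dt`.

In dimension three a weak solution is meant in the sense of Leray and Hopf, so that the energy
inequality is part of the definition (it is not known to follow from the other conditions).
In dimension two nothing is required beyond the other conditions. -/
structure IsWeakSolutionWith {d : ℕ} (Ω : Set (E d)) (ν : ℝ → ℝ) (f : ℝ → V' Ω) (u₀ : H Ω)
    (u : ℝ → H Ω) (U : ℝ → V Ω) (g : ℝ → V' Ω) : Prop where
  /-- `u(t) ∈ V` for almost every `t` -/
  coe_eq : ∀ᵐ t ∂volume.restrict (Ioi (0 : ℝ)), (u t : L2Vec Ω) = field (U t)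
  /-- `u ∈ L²(0,T;V)` -/
  memL2 : ∀ T : ℝ, 0 < T → MemLp U 2 (volume.restrict (Ioo 0 T))
  /-- `u` is weakly continuous in `H` -/
  weakCont : ∀ h : H Ω, ContinuousOn (fun t => (inner ℝ (u t) h : ℝ)) (Ici 0)
  /-- `du/dt ∈ L¹_loc((0,T];V')` -/
  derivL1 : ∀ ε T : ℝ, 0 < ε → ε < T → IntegrableOn g (Icc ε T)
  isTimeDeriv : IsTimeDeriv u g
  /-- `⟨du/dt, v⟩ + ν a(u,v) + b(u,u,v) = ⟨f,v⟩` -/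
  weakForm : ∀ᵐ t ∂volume.restrict (Ioi (0 : ℝ)), ∀ v : V Ω,
    g t v + ν t * formA (U t) v + formB (U t) (U t) v = f t v
  initial : u 0 = u₀
  /-- the energy inequality, in dimension three, for almost all starting times -/
  energy : d = 3 → ∀ᵐ s ∂volume.restrict (Ioi (0 : ℝ)), ∀ t : ℝ, s ≤ t →
    (1 / 2 : ℝ) * ‖u t‖ ^ 2 + ∫ τ in s..t, ν τ * ‖grad (U τ)‖ ^ 2 ≤
      (1 / 2 : ℝ) * ‖u s‖ ^ 2 + ∫ τ in s..t, f τ (U τ)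

/-- `u` is a weak solution on `[0, ∞)` of the Navier-Stokes equations with data `ν`, `f`, `u₀`. -/
def IsWeakSolution {d : ℕ} (Ω : Set (E d)) (ν : ℝ → ℝ) (f : ℝ → V' Ω) (u₀ : H Ω)
    (u : ℝ → H Ω) : Prop :=
  ∃ (U : ℝ → V Ω) (g : ℝ → V' Ω), IsWeakSolutionWith Ω ν f u₀ u U g

/-- `K̄ = limsup_{t → ∞} ∫₀ᵗ exp(-(∫ₛᵗ ν(z) dz) / c²) ds`. -/
def Kbar (ν : ℝ → ℝ) (c : ℝ) : ℝ≥0∞ :=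
  limsup (fun t : ℝ => ENNReal.ofReal (∫ s in (0 : ℝ)..t, Real.exp (-(∫ z in s..t, ν z) / c ^ 2)))
    atTop

end NSE

end

/-! The proof runs an energy estimate for y(t) = ‖u(t)‖_H² and never differentiates y. Suppose
‖f‖²_{V'} ≤ A almost everywhere after some time. Doubling the energy inequality gives two copies of
the dissipation ν‖u‖_V². Young's inequality 2⟨f,u⟩ ≤ A/ν + ν‖u‖_V² uses up one, and Poincaré bounds
the other below by (ν/c_ρ²)‖u‖_H². Hence, for almost every late s and all t ≥ s, y(t) + ∫_s^t
(ν/c_ρ²) y ≤ y(s) + (A/ν_low)(t - s) (`damped_energy`). A Gronwall lemma that accepts such an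
inequality for almost every starting time (`damped_gronwall`) turns this into an exponentially
decaying multiple of y(s) plus A/ν_low times the integral defining K̄. Taking the limsup in t, then
letting A decrease to the essential limsup of ‖f‖²_{V'}, gives the theorem.

In dimension three the energy inequality is part of the definition; in dimension two it is proved
(`energy_planar`). By Ladyzhenskaya's inequality and antisymmetry of b, the functional b(u,u,·) has
norm at most C‖u‖_H‖u‖_V, so du/dt is locally square integrable in time with values in V'. A weakly
continuous function with such a derivative satisfies ‖u(t)‖² ≤ ‖u(s)‖² + 2∫⟨du/dt,u⟩ for almost
every s (`energy_inequality_of_evolution`), by averaging over short time shifts. Since b(u,u,u) = 0,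
this is the energy inequality.

The distributional derivative enters only through its pairings with fixed v, where
`sub_eq_integral_of_weakDeriv` turns it into an integral identity between any two positive times. -/

namespace NSE

/-! ### Absolute continuity and a damped Gronwall inequality -/

theorem lipschitzOnWith_comp_absolutelyContinuousOnInterval {φ f : ℝ → ℝ} {a b : ℝ} {K : NNReal}
    {s : Set ℝ} (hφ : LipschitzOnWith K φ s) (hf : AbsolutelyContinuousOnInterval f a b)
    (hs : MapsTo f (uIcc a b) s) : AbsolutelyContinuousOnInterval (fun x => φ (f x)) a b := by
  rw [absolutelyContinuousOnInterval_iff] at hf ⊢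
  intro ε hε
  obtain ⟨δ, hδ, h⟩ := hf (ε / (K + 1)) (by positivity)
  refine ⟨δ, hδ, fun E hE hEδ => ?_⟩
  have h1 := h E hE hEδ
  calc _ ≤ ∑ i ∈ Finset.range E.1, K * dist (f (E.2 i).1) (f (E.2 i).2) :=
        Finset.sum_le_sum fun i hi =>
          hφ.dist_le_mul _ (hs (hE.1 i hi).1) _ (hs (hE.1 i hi).2)
    _ = K * ∑ i ∈ Finset.range E.1, dist (f (E.2 i).1) (f (E.2 i).2) := by rw [Finset.mul_sum]
    _ ≤ (K + 1) * ∑ i ∈ Finset.range E.1, dist (f (E.2 i).1) (f (E.2 i).2) := by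
        gcongr
        linarith
    _ < (K + 1) * (ε / (K + 1)) := by gcongr
    _ = ε := by field_simp

/-- An absolutely continuous function is bounded on the interval, and exp is Lipschitz on bounded
sets. -/
theorem absolutelyContinuousOnInterval_exp {f : ℝ → ℝ} {a b : ℝ}
    (hf : AbsolutelyContinuousOnInterval f a b) :
    AbsolutelyContinuousOnInterval (fun x => Real.exp (f x)) a b := by
  obtain ⟨C, hC⟩ := hf.exists_bound
  obtain ⟨K, hK⟩ := (Real.contDiff_exp (n := 1)).contDiffOn.exists_lipschitzOnWith (by decide)
    (convex_Icc (-C) C) isCompact_Icc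
  exact lipschitzOnWith_comp_absolutelyContinuousOnInterval hK hf
    fun x hx => abs_le.1 (hC x hx)

/-- A Gronwall inequality with damping: the integral inequality is only required to hold between
almost every earlier time and the final time. -/
theorem damped_gronwall {y γ : ℝ → ℝ} {s t A : ℝ} (hst : s ≤ t)
    (hγ : IntervalIntegrable γ volume s t)
    (hγ0 : ∀ r ∈ Icc s t, 0 ≤ γ r)
    (hγy : IntervalIntegrable (fun r => γ r * y r) volume s t)
    (h : ∀ᵐ r, r ∈ Icc s t → y t + (∫ τ in r..t, γ τ * y τ) - A * (t - r) ≤ y r)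
    (hs : y t + (∫ τ in s..t, γ τ * y τ) - A * (t - s) ≤ y s) :
    y t ≤ Real.exp (-∫ τ in s..t, γ τ) * y s +
      A * ∫ r in s..t, Real.exp (-∫ τ in r..t, γ τ) := by
  set Γ : ℝ → ℝ := fun r => ∫ τ in s..r, γ τ with hΓ
  set X : ℝ → ℝ := fun r => ∫ τ in s..r, γ τ * y τ with hX
  have hΓac : AbsolutelyContinuousOnInterval Γ s t :=
    hγ.absolutelyContinuousOnInterval_intervalIntegral left_mem_uIcc
  have hXac : AbsolutelyContinuousOnInterval X s t :=
    hγy.absolutelyContinuousOnInterval_intervalIntegral left_mem_uIcc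
  have hE := absolutelyContinuousOnInterval_exp hΓac
  have hlin : AbsolutelyContinuousOnInterval (fun r => y t + X t - A * (t - r)) s t :=
    ContDiffOn.absolutelyContinuousOnInterval (by fun_prop)
  -- y itself need not be continuous. Its lower bound Z(r) = y(t) + ∫_r^t γy - A(t - r) is
  -- absolutely continuous, with Z ≤ y almost everywhere, Z(s) ≤ y(s) and Z(t) = y(t).
  set Z : ℝ → ℝ := (fun r => y t + X t - A * (t - r)) - X with hZ
  have hF : AbsolutelyContinuousOnInterval ((fun r => Real.exp (Γ r)) * Z) s t :=
    hE.mul (hlin.sub hXac)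
  have hsub : ∀ {φ : ℝ → ℝ} (_ : IntervalIntegrable φ volume s t) (r : ℝ), r ∈ Icc s t →
      ∫ τ in r..t, φ τ = (∫ τ in s..t, φ τ) - ∫ τ in s..r, φ τ := by
    intro φ hφ r hr
    rw [intervalIntegral.integral_interval_sub_left hφ]
    exact hφ.mono_set (by rw [uIcc_of_le hr.1, uIcc_of_le hst]; exact Icc_subset_Icc_right hr.2)
  have key := hF.integral_deriv_eq_sub
  -- Since Z' = A - γy, the derivative of e^Γ Z is e^Γ(γ(Z - y) + A), and γ(Z - y) ≤ 0.
  have hderiv : ∀ᵐ r, r ∈ Icc s t →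
      deriv ((fun r => Real.exp (Γ r)) * Z) r ≤ A * Real.exp (Γ r) := by
    filter_upwards [hγ.ae_hasDerivAt_integral, hγy.ae_hasDerivAt_integral, h] with r h1 h2 h3 hr
    have hr' : r ∈ uIcc s t := by rwa [uIcc_of_le hst]
    have d1 : HasDerivAt Γ (γ r) r := h1 hr' s left_mem_uIcc
    have d2 : HasDerivAt X (γ r * y r) r := h2 hr' s left_mem_uIcc
    have d3 : HasDerivAt (fun r => y t + X t - A * (t - r)) A r := by
      simpa using (((hasDerivAt_id r).const_sub t).const_mul A).const_sub (y t + X t)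
    rw [(d1.exp.mul (d3.sub d2)).deriv]
    have h4 : Z r ≤ y r := by
      have := h3 hr
      rw [hsub hγy r hr] at this
      simp only [hZ, Pi.sub_apply]
      change y t + X t - A * (t - r) - X r ≤ y r
      have e : (∫ τ in s..t, γ τ * y τ) - (∫ τ in s..r, γ τ * y τ) = X t - X r := rfl
      rw [e] at this
      linarith
    have h5 := mul_le_mul_of_nonneg_left h4 (mul_nonneg (Real.exp_pos (Γ r)).le (hγ0 r hr))
    have e2 : (fun r => y t + X t - A * (t - r)) r - X r = Z r := rfl
    simp only [Pi.sub_apply] at *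
    rw [e2]
    linarith
  have hEint : IntervalIntegrable (fun r => A * Real.exp (Γ r)) volume s t :=
    (hE.continuousOn.intervalIntegrable).const_mul A
  have hle : ∫ r in s..t, deriv ((fun r => Real.exp (Γ r)) * Z) r ≤
      ∫ r in s..t, A * Real.exp (Γ r) := by
    refine intervalIntegral.integral_mono_ae_restrict hst hF.intervalIntegrable_deriv hEint ?_
    exact (ae_restrict_iff' measurableSet_Icc).2 hderiv
  rw [key] at hle
  have hΓs : Γ s = 0 := by simp [hΓ]
  have hXs : X s = 0 := by simp [hX]
  have hZs : Z s ≤ y s := by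
    simp only [hZ, Pi.sub_apply, hXs]
    linarith [hs]
  have hZt : Z t = y t := by simp [hZ]
  simp only [Pi.mul_apply, hΓs, hZt, Real.exp_zero, one_mul] at hle
  have e3 : ∫ r in s..t, Real.exp (-∫ τ in r..t, γ τ) =
      Real.exp (-Γ t) * ∫ r in s..t, Real.exp (Γ r) := by
    rw [← intervalIntegral.integral_const_mul]
    refine intervalIntegral.integral_congr fun r hr => ?_
    rw [uIcc_of_le hst] at hr
    change Real.exp (-∫ τ in r..t, γ τ) = Real.exp (-Γ t) * Real.exp (Γ r)
    rw [hsub hγ r hr, ← Real.exp_add]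
    congr 1
    change -(Γ t - Γ r) = _
    ring
  rw [intervalIntegral.integral_const_mul] at hle
  rw [e3]
  have h6 : Real.exp (-Γ t) * (Real.exp (Γ t) * y t) = y t := by
    rw [← mul_assoc, ← Real.exp_add]; simp
  have h7 : Real.exp (Γ t) * y t ≤ y s + A * ∫ r in s..t, Real.exp (Γ r) := by linarith
  have h8 := mul_le_mul_of_nonneg_left h7 (Real.exp_pos (-Γ t)).le
  rw [h6] at h8
  change y t ≤ Real.exp (-Γ t) * y s + _
  linarith

/-! ### Approximation by test fields, the Poincaré inequality and the dual norm -/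

section TestFields

variable {d : ℕ} {Ω : Set (E d)}

/-- The field underlying an element of `V`, as a continuous linear map. -/
noncomputable def fieldL (Ω : Set (E d)) : V Ω →L[ℝ] L2Vec Ω :=
  (WithLp.fstL 2 ℝ (L2Vec Ω) (L2Mat Ω)).comp (testH1 Ω).topologicalClosure.subtypeL

/-- The gradient of an element of `V`, as a continuous linear map. -/
noncomputable def gradL (Ω : Set (E d)) : V Ω →L[ℝ] L2Mat Ω :=
  (WithLp.sndL 2 ℝ (L2Vec Ω) (L2Mat Ω)).comp (testH1 Ω).topologicalClosure.subtypeL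

theorem gradL_apply (v : V Ω) : gradL Ω v = grad v := rfl

theorem norm_sq_eq (v : V Ω) : ‖v‖ ^ 2 = ‖field v‖ ^ 2 + ‖grad v‖ ^ 2 :=
  WithLp.prod_norm_sq_eq_of_L2 (Subtype.val v)

theorem norm_field_le (v : V Ω) : ‖field v‖ ≤ ‖v‖ := by
  have := norm_sq_eq v
  exact abs_le_of_sq_le_sq' (by nlinarith [sq_nonneg ‖grad v‖]) (norm_nonneg _) |>.2

theorem norm_grad_le (v : V Ω) : ‖grad v‖ ≤ ‖v‖ := by
  have := norm_sq_eq v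
  exact abs_le_of_sq_le_sq' (by nlinarith [sq_nonneg ‖field v‖]) (norm_nonneg _) |>.2

/-- `φ` is a test field representing `v`. -/
def Represents (φ : E d → E d) (v : V Ω) : Prop :=
  IsTestField Ω φ ∧ field v =ᵐ[volume.restrict Ω] φ ∧
    grad v =ᵐ[volume.restrict Ω] gradField φ

/-- Density of test fields in V: inequalities and identities are proved for smooth fields and
carried to V along such a sequence. -/
theorem exists_seq_represents (v : V Ω) :
    ∃ (w : ℕ → V Ω) (φ : ℕ → E d → E d), (∀ n, Represents (φ n) (w n)) ∧
      Tendsto w atTop (𝓝 v) := by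
  obtain ⟨x, hx, hlim⟩ := mem_closure_iff_seq_limit.1 v.2
  choose φ hφ using hx
  refine ⟨fun n => ⟨x n, subset_closure ⟨φ n, hφ n⟩⟩, φ, hφ, ?_⟩
  exact tendsto_subtype_rng.2 hlim

/-- Cauchy–Schwarz in each row: the operator norm is at most the Frobenius norm. This links Sobolev
inequalities phrased with `fderiv` to `grad`. -/
theorem norm_fderiv_le_gradField (φ : E d → E d) (x : E d) :
    ‖fderiv ℝ φ x‖ ≤ ‖gradField φ x‖ := by
  refine ContinuousLinearMap.opNorm_le_bound _ (norm_nonneg _) fun y => ?_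
  refine abs_le_of_sq_le_sq' ?_ (by positivity) |>.2
  have hy : ∀ i, fderiv ℝ φ x y i = ∑ j, partialDeriv φ i j x * y j := by
    intro i
    conv_lhs => rw [← (EuclideanSpace.basisFun (Fin d) ℝ).sum_repr y]
    simp [partialDeriv, mul_comm]
  rw [mul_pow, EuclideanSpace.norm_sq_eq, EuclideanSpace.norm_sq_eq, EuclideanSpace.norm_sq_eq,
    Fintype.sum_prod_type, Finset.sum_mul]
  refine Finset.sum_le_sum fun i _ => ?_
  simp only [hy, Real.norm_eq_abs, sq_abs, gradField]
  exact Finset.sum_mul_sq_le_sq_mul_sq _ _ _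

theorem IsTestField.continuous_partialDeriv {φ : E d → E d} (hφ : IsTestField Ω φ) (i j : Fin d) :
    Continuous (partialDeriv φ i j) := by
  have := hφ.1.continuous_fderiv (by simp)
  unfold partialDeriv
  fun_prop

theorem partialDeriv_eq_zero_of_notMem {φ : E d → E d} {x : E d} (hx : x ∉ tsupport φ)
    (i j : Fin d) : partialDeriv φ i j x = 0 := by
  simp [partialDeriv, fderiv_of_notMem_tsupport (𝕜 := ℝ) hx]

theorem support_gradField_subset (φ : E d → E d) :
    Function.support (gradField φ) ⊆ tsupport φ := by
  intro x hx
  by_contra h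
  exact hx (by ext p; simp [gradField, partialDeriv_eq_zero_of_notMem h])

theorem Represents.eLpNorm_field {φ : E d → E d} {v : V Ω} (h : Represents φ v) (p : ℝ≥0∞) :
    eLpNorm (field v) p (volume.restrict Ω) = eLpNorm φ p volume := by
  rw [eLpNorm_congr_ae h.2.1]
  exact eLpNorm_restrict_eq_of_support_subset ((subset_tsupport φ).trans h.1.2.2.1)

theorem Represents.eLpNorm_grad {φ : E d → E d} {v : V Ω} (h : Represents φ v) (p : ℝ≥0∞) :
    eLpNorm (grad v) p (volume.restrict Ω) = eLpNorm (gradField φ) p volume := by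
  rw [eLpNorm_congr_ae h.2.2]
  exact eLpNorm_restrict_eq_of_support_subset ((support_gradField_subset φ).trans h.1.2.2.1)

/-- The Poincaré inequality. -/
theorem exists_poincare (hd : d = 2 ∨ d = 3) (hΩb : Bornology.IsBounded Ω) :
    ∃ C : ℝ, 0 ≤ C ∧ ∀ v : V Ω, ‖field v‖ ≤ C * ‖grad v‖ := by
  have hfin : volume Ω < ⊤ := hΩb.measure_lt_top
  have : IsFiniteMeasure (volume.restrict Ω) := ⟨by simpa using hfin⟩
  -- The Sobolev inequality requires a gradient exponent below d, which excludes 2 in the plane. The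
  -- exponent 3/2 serves both dimensions; Hölder on the bounded set Ω then replaces it by 2, at the
  -- cost of the factor m.
  set S := eLpNormLESNormFDerivOfLeConst (E d) (volume : Measure (E d)) Ω (3 / 2) 2
  set m : ℝ≥0∞ := volume.restrict Ω univ ^
    (1 / (3 / 2 : ℝ≥0∞).toReal - 1 / (2 : ℝ≥0∞).toReal) with hm
  have hmtop : m ≠ ⊤ := by
    refine ENNReal.rpow_ne_top_of_nonneg ?_ (measure_ne_top _ _)
    norm_num
  refine ⟨S * m.toReal, by positivity, fun v => ?_⟩
  obtain ⟨w, φ, hφ, hw⟩ := exists_seq_represents v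
  have key : ∀ n, ‖field (w n)‖ ≤ S * m.toReal * ‖grad (w n)‖ := by
    intro n
    have hT := (hφ n).1
    have h1 : eLpNorm (φ n) 2 volume ≤ S * eLpNorm (fderiv ℝ (φ n)) ((3 / 2 : NNReal) : ℝ≥0∞)
        volume := by
      refine eLpNorm_le_eLpNorm_fderiv_of_le volume (hT.1.of_le (by simp))
        ((subset_tsupport _).trans hT.2.2.1) (p := 3 / 2) (q := 2) ?_ ?_ ?_ hΩb
      · rw [← NNReal.coe_le_coe]; norm_num
      · rw [← NNReal.coe_lt_coe]; rcases hd with rfl | rfl <;> norm_num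
      · rcases hd with rfl | rfl <;> norm_num
    have h2 : eLpNorm (fderiv ℝ (φ n)) ((3 / 2 : NNReal) : ℝ≥0∞) volume ≤
        eLpNorm (grad (w n)) (3 / 2) (volume.restrict Ω) := by
      rw [(hφ n).eLpNorm_grad]
      refine (eLpNorm_mono (norm_fderiv_le_gradField _)).trans_eq ?_
      congr 1
      rw [ENNReal.coe_div (by norm_num)]; rfl
    have h3 := eLpNorm_le_eLpNorm_mul_rpow_measure_univ (μ := volume.restrict Ω)
      (p := 3 / 2) (q := 2) (by
        rw [ENNReal.div_le_iff (by norm_num) (by norm_num)]; norm_num)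
      (Lp.aestronglyMeasurable (grad (w n)))
    rw [← (hφ n).eLpNorm_field] at h1
    have h4 : eLpNorm (field (w n)) 2 (volume.restrict Ω) ≤
        S * (eLpNorm (grad (w n)) 2 (volume.restrict Ω) * m) := h1.trans (by gcongr; exact h2.trans h3)
    have h5 := ENNReal.toReal_mono (by
      refine ENNReal.mul_ne_top ENNReal.coe_ne_top (ENNReal.mul_ne_top (Lp.eLpNorm_ne_top _) hmtop))
      h4
    rw [ENNReal.toReal_mul, ENNReal.toReal_mul] at h5
    rw [Lp.norm_def, Lp.norm_def]
    calc _ ≤ _ := h5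
      _ = _ := by simp only [ENNReal.coe_toReal]; ring
  have l1 : Tendsto (fun n => ‖field (w n)‖) atTop (𝓝 ‖field v‖) :=
    (((fieldL Ω).continuous.tendsto v).comp hw).norm
  have l2 : Tendsto (fun n => ‖grad (w n)‖) atTop (𝓝 ‖grad v‖) :=
    (((gradL Ω).continuous.tendsto v).comp hw).norm
  exact le_of_tendsto_of_tendsto' l1 (l2.const_mul _) key

theorem poincareConst_nonneg : 0 ≤ poincareConst Ω := Real.sInf_nonneg fun _ h => h.1

/-- The infimum is an admissible constant: divide by ‖∇v‖ when it is positive. The existence of some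
admissible constant matters twice, to make the set nonempty and to settle the case ∇v = 0. -/
theorem norm_field_le_poincareConst (hd : d = 2 ∨ d = 3) (hΩb : Bornology.IsBounded Ω) (v : V Ω) :
    ‖field v‖ ≤ poincareConst Ω * ‖grad v‖ := by
  obtain ⟨C, hC0, hC⟩ := exists_poincare hd hΩb
  rcases (norm_nonneg (grad v)).eq_or_lt with h0 | hpos
  · have := hC v
    rw [← h0] at this ⊢
    simpa using this
  · rw [← div_le_iff₀ hpos]
    refine le_csInf ⟨C, hC0, hC⟩ fun c hc => ?_
    rw [div_le_iff₀ hpos]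
    exact hc.2 v

/-- Rescaling v to ‖∇v‖ = 1 reduces to the definition of the supremum; if ∇v = 0, then v = 0 by
Poincaré. -/
theorem abs_apply_le_of_dualNorm_sq_le (hd : d = 2 ∨ d = 3) (hΩb : Bornology.IsBounded Ω)
    {f : V' Ω} {A : ℝ} (hf : dualNorm f ^ 2 ≤ ENNReal.ofReal A) (v : V Ω) :
    |f v| ≤ √A * ‖grad v‖ := by
  rcases (norm_nonneg (grad v)).eq_or_lt with h0 | hpos
  · have h1 := norm_field_le_poincareConst hd hΩb v
    have h2 := norm_sq_eq v
    rw [← h0, mul_zero] at h1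
    rw [← h0, le_antisymm h1 (norm_nonneg _)] at h2
    have : v = 0 := by simpa using h2
    rw [this, map_zero, abs_zero]
    positivity
  · have h1 : ‖f (‖grad v‖⁻¹ • v)‖ₑ ≤ dualNorm f := by
      refine le_iSup₂_of_le (‖grad v‖⁻¹ • v) ?_ le_rfl
      rw [← gradL_apply, map_smul, norm_smul, gradL_apply, norm_inv, norm_norm,
        inv_mul_cancel₀ hpos.ne']
    have h2 : ‖f (‖grad v‖⁻¹ • v)‖ₑ ^ 2 ≤ ENNReal.ofReal A := (by gcongr : _ ≤ _).trans hf
    rw [← ofReal_norm, ← ENNReal.ofReal_pow (norm_nonneg _)] at h2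
    have h3 : ‖f (‖grad v‖⁻¹ • v)‖ ≤ √A := by
      rcases le_or_gt 0 A with hA | hA
      · exact Real.le_sqrt_of_sq_le ((ENNReal.ofReal_le_ofReal_iff hA).1 h2)
      · rw [ENNReal.ofReal_of_nonpos hA.le, nonpos_iff_eq_zero, ENNReal.ofReal_eq_zero] at h2
        have : ‖f (‖grad v‖⁻¹ • v)‖ = 0 := by
          have := sq_nonneg ‖f (‖grad v‖⁻¹ • v)‖
          exact pow_eq_zero_iff (two_ne_zero) |>.1 (le_antisymm h2 this)
        rw [this]; positivity
    rw [map_smul, norm_smul, norm_inv, norm_norm, inv_mul_le_iff₀ hpos, mul_comm] at h3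
    exact h3

end TestFields

/-! ### The trilinear form: antisymmetry on test fields and Hölder bounds -/

section TrilinearForm

variable {d : ℕ} {Ω : Set (E d)}

/-- Integration by parts against the constant function 1. -/
theorem integral_fderiv_apply_eq_zero {F : E d → ℝ} (hF : ContDiff ℝ 1 F)
    (hc : HasCompactSupport F) (e : E d) : ∫ x, fderiv ℝ F x e = 0 := by
  have hcont : Continuous fun x => fderiv ℝ F x e :=
    (hF.continuous_fderiv (by simp)).clm_apply continuous_const
  have hi : Integrable fun x => fderiv ℝ F x e :=
    hcont.integrable_of_hasCompactSupport (hc.fderiv_apply ℝ e)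
  have h := integral_mul_fderiv_eq_neg_fderiv_mul_of_integrable (𝕜 := ℝ) (μ := volume)
    (f := fun _ : E d => (1 : ℝ)) (g := F) (v := e) (by simp) (by simpa using hi)
    (by simpa using hF.continuous.integrable_of_hasCompactSupport hc)
    (fun x _ => by fun_prop) (fun x _ => hF.differentiable (by simp) x)
  simpa using h

theorem formB_eq_integral {φ ψ χ : E d → E d} {u v w : V Ω} (hu : Represents φ u)
    (hv : Represents ψ v) (hw : Represents χ w) :
    formB u v w = ∫ x, ∑ i, ∑ j, φ x j * partialDeriv ψ i j x * χ x i := by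
  unfold formB
  rw [← setIntegral_eq_integral_of_forall_compl_eq_zero (s := Ω)
    (f := fun x => ∑ i, ∑ j, φ x j * partialDeriv ψ i j x * χ x i)]
  · refine integral_congr_ae ?_
    filter_upwards [hu.2.1, hv.2.2, hw.2.1] with x h1 h2 h3
    simp only [h1, h2, h3, gradField]
  · intro x hx
    have : φ x = 0 := image_eq_zero_of_notMem_tsupport fun h => hx (hu.1.2.2.1 h)
    simp [this]

/-- The sum of the two integrands is the divergence of (φ·ψ)φ, because φ is divergence free, and the
divergence of a compactly supported field integrates to zero. -/
theorem formB_self_antisymm_of_represents {φ ψ : E d → E d} {u v : V Ω} (hu : Represents φ u)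
    (hv : Represents ψ v) : formB u u v = -formB u v u := by
  rw [formB_eq_integral hu hu hv, formB_eq_integral hu hv hu, eq_neg_iff_add_eq_zero]
  have hφ := hu.1.1
  have hψ := hv.1.1
  have hci : ∀ i, ContDiff ℝ 1 fun x => φ x i := fun i =>
    (contDiff_euclidean.1 (hφ.of_le (by simp))) i
  have hcj : ∀ i, ContDiff ℝ 1 fun x => ψ x i := fun i =>
    (contDiff_euclidean.1 (hψ.of_le (by simp))) i
  have hp1 : ∀ i j, Continuous (partialDeriv φ i j) := hu.1.continuous_partialDeriv
  have hp2 : ∀ i j, Continuous (partialDeriv ψ i j) := hv.1.continuous_partialDeriv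
  have hsupp : ∀ F : E d → ℝ, Continuous F → (∀ x, φ x = 0 → F x = 0) → Integrable F := by
    intro F hF h0
    refine hF.integrable_of_hasCompactSupport (hu.1.2.1.mono fun x hx h => hx (h0 x h))
  have c1 : Continuous fun x => ∑ i, ∑ j, φ x j * partialDeriv φ i j x * ψ x i := by
    have := fun i => (hci i).continuous
    have := fun i => (hcj i).continuous
    fun_prop
  have c2 : Continuous fun x => ∑ i, ∑ j, φ x j * partialDeriv ψ i j x * φ x i := by
    have := fun i => (hci i).continuous
    fun_prop
  rw [← integral_add (hsupp _ c1 fun x h => by simp [h]) (hsupp _ c2 fun x h => by simp [h])]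
  set F : Fin d → E d → ℝ := fun j x => φ x j * ∑ i, φ x i * ψ x i with hF
  have hFc : ∀ j, ContDiff ℝ 1 (F j) := fun j =>
    (hci j).mul (ContDiff.sum fun i _ => (hci i).mul (hcj i))
  have hFs : ∀ j, HasCompactSupport (F j) := fun j =>
    hu.1.2.1.mono fun x hx h => hx (by simp [hF, h])
  have hder : ∀ (θ : E d → E d), ContDiff ℝ ∞ θ → ∀ i x e,
      HasFDerivAt (fun y => θ y i) ((EuclideanSpace.proj i).comp (fderiv ℝ θ x)) x ∧
      ((EuclideanSpace.proj i).comp (fderiv ℝ θ x) : E d →L[ℝ] ℝ) e = fderiv ℝ θ x e i := by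
    intro θ hθ i x e
    exact ⟨(EuclideanSpace.proj i : E d →L[ℝ] ℝ).hasFDerivAt.comp x
      (hθ.differentiable (by simp) x).hasFDerivAt, rfl⟩
  have hFd : ∀ j x, fderiv ℝ (F j) x (EuclideanSpace.single j 1) =
      partialDeriv φ j j x * (∑ i, φ x i * ψ x i) +
        ∑ i, (φ x j * partialDeriv φ i j x * ψ x i + φ x j * partialDeriv ψ i j x * φ x i) := by
    intro j x
    have hs : HasFDerivAt (fun y => ∑ i, φ y i * ψ y i) _ x :=
      HasFDerivAt.fun_sum fun i _ => ((hder φ hφ i x 0).1.mul (hder ψ hψ i x 0).1)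
    have hFj : HasFDerivAt (F j) _ x := (hder φ hφ j x 0).1.mul hs
    rw [hFj.fderiv]
    have hproj : ∀ (i : Fin d) (z : E d), (EuclideanSpace.proj i : E d →L[ℝ] ℝ) z = z i :=
      fun _ _ => rfl
    simp only [add_apply, smul_apply, sum_apply, ContinuousLinearMap.comp_apply, smul_eq_mul,
      partialDeriv, hproj, Finset.mul_sum, Finset.sum_mul]
    rw [← Finset.sum_add_distrib, ← Finset.sum_add_distrib]
    exact Finset.sum_congr rfl fun i _ => by ring
  calc _ = ∫ x, ∑ j, fderiv ℝ (F j) x (EuclideanSpace.single j 1) := by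
        refine integral_congr_ae (.of_forall fun x => ?_)
        simp only [hFd, Finset.sum_add_distrib]
        rw [← Finset.sum_mul, hu.1.2.2.2 x, zero_mul, zero_add]
        congr 1 <;> exact Finset.sum_comm
    _ = ∑ j, ∫ x, fderiv ℝ (F j) x (EuclideanSpace.single j 1) := by
        refine integral_finsetSum _ fun j _ => ?_
        exact (((hFc j).continuous_fderiv (by simp)).clm_apply
          continuous_const).integrable_of_hasCompactSupport ((hFs j).fderiv_apply ℝ _)
    _ = 0 := Finset.sum_eq_zero fun j _ => integral_fderiv_apply_eq_zero (hFc j) (hFs j) _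

/-- Cauchy–Schwarz for the Frobenius pairing of b ⊗ a with G, as ‖b ⊗ a‖ = ‖a‖‖b‖. -/
theorem abs_sum_mul_le (a b : E d) (G : M d) :
    |∑ i, ∑ j, a j * G (i, j) * b i| ≤ ‖a‖ * ‖b‖ * ‖G‖ := by
  refine abs_le_of_sq_le_sq' ?_ (by positivity) |> abs_le.2
  have e : ∑ i, ∑ j, a j * G (i, j) * b i = ∑ p : Fin d × Fin d, (b p.1 * a p.2) * G p := by
    rw [Fintype.sum_prod_type]
    exact Finset.sum_congr rfl fun i _ => Finset.sum_congr rfl fun j _ => by ring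
  rw [e, mul_pow, mul_pow, EuclideanSpace.norm_sq_eq, EuclideanSpace.norm_sq_eq,
    EuclideanSpace.norm_sq_eq]
  refine (Finset.sum_mul_sq_le_sq_mul_sq _ _ _).trans_eq ?_
  simp only [Real.norm_eq_abs, sq_abs]
  congr 1
  rw [Fintype.sum_prod_type, mul_comm, Finset.sum_mul_sum]
  exact Finset.sum_congr rfl fun i _ => Finset.sum_congr rfl fun j _ => by ring

instance : ENNReal.HolderTriple 4 4 2 where
  inv_add_inv_eq_inv := by
    rw [← two_mul, show (4 : ℝ≥0∞) = 2 * 2 by norm_num,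
      ENNReal.mul_inv (by simp) (by simp), ← mul_assoc, ENNReal.mul_inv_cancel (by simp) (by simp),
      one_mul]

/-- The integrand of the trilinear form is integrable, with a Hölder bound, for fields in `L⁴`. -/
theorem integrable_trilinear {a b : E d → E d} {G : E d → M d} {μ : Measure (E d)}
    (ha : MemLp a 4 μ) (hb : MemLp b 4 μ) (hG : MemLp G 2 μ) :
    Integrable (fun x => ∑ i, ∑ j, a x j * G x (i, j) * b x i) μ ∧
      |∫ x, ∑ i, ∑ j, a x j * G x (i, j) * b x i ∂μ| ≤
        (eLpNorm a 4 μ).toReal * (eLpNorm b 4 μ).toReal * (eLpNorm G 2 μ).toReal := by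
  have hab : MemLp (fun x => ‖a x‖ * ‖b x‖) 2 μ := hb.norm.mul' ha.norm
  have habG : MemLp (fun x => (‖a x‖ * ‖b x‖) * ‖G x‖) 1 μ := hG.norm.mul' hab
  have hmeas : AEStronglyMeasurable (fun x => ∑ i, ∑ j, a x j * G x (i, j) * b x i) μ := by
    have ha' := fun i => (EuclideanSpace.proj (𝕜 := ℝ) i).continuous.comp_aestronglyMeasurable ha.1
    have hb' := fun i => (EuclideanSpace.proj (𝕜 := ℝ) i).continuous.comp_aestronglyMeasurable hb.1
    have hG' := fun i => (EuclideanSpace.proj (𝕜 := ℝ) i).continuous.comp_aestronglyMeasurable hG.1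
    exact Finset.aestronglyMeasurable_fun_sum _ fun i _ =>
      Finset.aestronglyMeasurable_fun_sum _ fun j _ => ((ha' j).mul (hG' (i, j))).mul (hb' i)
  have hle : ∀ x, ‖∑ i, ∑ j, a x j * G x (i, j) * b x i‖ ≤ ‖(‖a x‖ * ‖b x‖) * ‖G x‖‖ := fun x => by
    rw [Real.norm_eq_abs, Real.norm_of_nonneg (by positivity)]
    exact abs_sum_mul_le _ _ _
  have hint := memLp_one_iff_integrable.1 (habG.mono hmeas (.of_forall hle))
  refine ⟨hint, ?_⟩
  have h1 : eLpNorm (fun x => ‖a x‖ * ‖b x‖) 2 μ ≤ eLpNorm a 4 μ * eLpNorm b 4 μ := by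
    have := eLpNorm_smul_le_mul_eLpNorm (p := 4) (q := 4) (r := 2) hb.norm.1 ha.norm.1
    rwa [eLpNorm_norm, eLpNorm_norm] at this
  have h2 : eLpNorm (fun x => (‖a x‖ * ‖b x‖) * ‖G x‖) 1 μ ≤
      eLpNorm a 4 μ * eLpNorm b 4 μ * eLpNorm G 2 μ := by
    have := eLpNorm_smul_le_mul_eLpNorm (p := 2) (q := 2) (r := 1) hG.norm.1 hab.1
    rw [eLpNorm_norm] at this
    exact this.trans (by gcongr)
  have h3 : eLpNorm (fun x => ∑ i, ∑ j, a x j * G x (i, j) * b x i) 1 μ ≤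
      eLpNorm a 4 μ * eLpNorm b 4 μ * eLpNorm G 2 μ := (eLpNorm_mono hle).trans h2
  rw [eLpNorm_one_eq_lintegral_enorm] at h3
  rw [← ENNReal.toReal_mul, ← ENNReal.toReal_mul]
  refine (norm_integral_le_lintegral_norm
    (fun x => ∑ i, ∑ j, a x j * G x (i, j) * b x i)).trans ?_
  simp only [ofReal_norm]
  exact ENNReal.toReal_mono
    (ENNReal.mul_ne_top (ENNReal.mul_ne_top ha.eLpNorm_ne_top hb.eLpNorm_ne_top)
      hG.eLpNorm_ne_top) h3

end TrilinearForm

/-! ### Ladyzhenskaya's inequality and the trilinear form on V in the plane -/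

section Planar

variable {Ω : Set (E 2)}

/-- Ladyzhenskaya's inequality for smooth compactly supported fields in the plane. -/
theorem exists_ladyzhenskaya_smooth : ∃ C : NNReal, ∀ φ : E 2 → E 2, ContDiff ℝ ∞ φ →
    HasCompactSupport φ →
      eLpNorm φ 4 volume ^ 2 ≤ C * (eLpNorm φ 2 volume * eLpNorm (fderiv ℝ φ) 2 volume) := by
  refine ⟨eLpNormLESNormFDerivOneConst (volume : Measure (E 2)) 2 * 2, fun φ hφ hc => ?_⟩
  have hφ1 : ContDiff ℝ 1 φ := hφ.of_le (by simp)
  -- In the plane the L² norm is controlled by the L¹ norm of the gradient. This is applied to |φ|²,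
  -- whose gradient is at most 2|φ||∇φ|; hence the extra factor 2 in the constant.
  have h1 : eLpNorm (fun x => ‖φ x‖ ^ 2) (2 : NNReal) volume ≤ _ :=
    eLpNorm_le_eLpNorm_fderiv_one volume (hφ1.norm_sq ℝ)
    (hc.mono fun x hx h => hx (by simp [h])) (p := 2) (by
      simp only [finrank_euclideanSpace, Fintype.card_fin]
      exact NNReal.HolderConjugate.two_two)
  have h2 : eLpNorm (fun x => ‖φ x‖ ^ 2) (2 : NNReal) volume = eLpNorm φ 4 volume ^ 2 := by
    have := eLpNorm_norm_rpow (p := 2) (μ := volume) φ (q := 2) (by norm_num)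
    rw [show (2 : ℝ≥0∞) * ENNReal.ofReal 2 = 4 by norm_num] at this
    rw [← ENNReal.rpow_two, ← this]
    simp
  have hd : ∀ x, ‖fderiv ℝ (fun x => ‖φ x‖ ^ 2) x‖ ≤ ‖(2 : ℝ) • (‖φ x‖ • ‖fderiv ℝ φ x‖)‖ := by
    intro x
    refine ContinuousLinearMap.opNorm_le_bound _ (norm_nonneg _) fun y => ?_
    rw [((hφ1.differentiable (by simp) x).hasFDerivAt.norm_sq).fderiv]
    simp only [norm_smul, norm_norm, Real.norm_ofNat, smul_apply, nsmul_eq_mul, Nat.cast_ofNat]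
    rw [norm_mul, Real.norm_ofNat]
    have h1 : ‖inner ℝ (φ x) (fderiv ℝ φ x y)‖ ≤ ‖φ x‖ * (‖fderiv ℝ φ x‖ * ‖y‖) :=
      (norm_inner_le_norm _ _).trans (by gcongr; exact (fderiv ℝ φ x).le_opNorm y)
    calc _ ≤ 2 * (‖φ x‖ * (‖fderiv ℝ φ x‖ * ‖y‖)) := by gcongr; exact h1
      _ = _ := by ring
  have h3 : eLpNorm (fderiv ℝ fun x => ‖φ x‖ ^ 2) 1 volume ≤
      2 * (eLpNorm φ 2 volume * eLpNorm (fderiv ℝ φ) 2 volume) := by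
    refine (eLpNorm_mono hd).trans ?_
    have h4 := eLpNorm_const_smul (2 : ℝ) (fun x => ‖φ x‖ • ‖fderiv ℝ φ x‖) 1
      (volume : Measure (E 2))
    have h5 := eLpNorm_smul_le_mul_eLpNorm (p := 2) (q := 2) (r := 1) (μ := volume)
      (hφ1.continuous_fderiv (by simp)).norm.aestronglyMeasurable
      hφ1.continuous.norm.aestronglyMeasurable
    rw [eLpNorm_norm, eLpNorm_norm] at h5
    refine h4.le.trans ?_
    rw [show ‖(2 : ℝ)‖ₑ = 2 by rw [← ofReal_norm]; simp]
    gcongr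
    exact h5
  rw [h2] at h1
  refine h1.trans ?_
  rw [ENNReal.coe_mul, mul_assoc]
  exact mul_le_mul_right h3 _

/-- Ladyzhenskaya's inequality on `V`. -/
theorem exists_ladyzhenskaya (Ω : Set (E 2)) : ∃ C : ℝ, 0 ≤ C ∧ ∀ v : V Ω,
    MemLp (field v) 4 (volume.restrict Ω) ∧
      (eLpNorm (field v) 4 (volume.restrict Ω)).toReal ^ 2 ≤ C * (‖field v‖ * ‖grad v‖) := by
  obtain ⟨C, hC⟩ := exists_ladyzhenskaya_smooth
  refine ⟨C, C.2, fun v => ?_⟩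
  obtain ⟨w, φ, hφ, hw⟩ := exists_seq_represents v
  have l1 : Tendsto (fun n => field (w n)) atTop (𝓝 (field v)) :=
    ((fieldL Ω).continuous.tendsto v).comp hw
  have l2 : Tendsto (fun n => grad (w n)) atTop (𝓝 (grad v)) :=
    ((gradL Ω).continuous.tendsto v).comp hw
  -- No convergence in L⁴ is needed: along an almost everywhere convergent subsequence, Fatou's
  -- lemma bounds the L⁴ norm of the limit.
  obtain ⟨ns, hns, hae⟩ := (tendstoInMeasure_of_tendsto_Lp l1).exists_seq_tendsto_ae
  have hkey : ∀ n, eLpNorm (field (w n)) 4 (volume.restrict Ω) ≤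
      (C * ENNReal.ofReal (‖field (w n)‖ * ‖grad (w n)‖)) ^ (1 / 2 : ℝ) := by
    intro n
    have h1 := hC _ (hφ n).1.1 (hφ n).1.2.1
    have h2 : eLpNorm (fderiv ℝ (φ n)) 2 volume ≤ eLpNorm (gradField (φ n)) 2 volume :=
      eLpNorm_mono (norm_fderiv_le_gradField _)
    rw [← (hφ n).eLpNorm_field, ← (hφ n).eLpNorm_field] at h1
    rw [← (hφ n).eLpNorm_grad] at h2
    rw [ENNReal.ofReal_mul (norm_nonneg _), ofReal_norm, ofReal_norm, Lp.enorm_def, Lp.enorm_def]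
    rw [one_div, ENNReal.le_rpow_inv_iff (by norm_num), ENNReal.rpow_two]
    exact h1.trans (by gcongr)
  have hlim : Tendsto (fun n => (C * ENNReal.ofReal (‖field (w (ns n))‖ * ‖grad (w (ns n))‖)) ^
      (1 / 2 : ℝ)) atTop (𝓝 ((C * ENNReal.ofReal (‖field v‖ * ‖grad v‖)) ^ (1 / 2 : ℝ))) := by
    refine (ENNReal.continuous_rpow_const.tendsto _).comp ?_
    refine ENNReal.Tendsto.const_mul ?_ (Or.inr ENNReal.coe_ne_top)
    refine (ENNReal.continuous_ofReal.tendsto _).comp ?_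
    exact ((l1.norm.mul l2.norm).comp hns.tendsto_atTop)
  have hfin := Lp.eLpNorm_lim_le_liminf_eLpNorm (p := 4)
    (fun n => Lp.aestronglyMeasurable (field (w (ns n)))) (field v) hae
  have hle : eLpNorm (field v) 4 (volume.restrict Ω) ≤
      (C * ENNReal.ofReal (‖field v‖ * ‖grad v‖)) ^ (1 / 2 : ℝ) := by
    refine hfin.trans ?_
    rw [← hlim.liminf_eq]
    exact liminf_le_liminf (.of_forall fun n => hkey (ns n))
  have hmem : MemLp (field v) 4 (volume.restrict Ω) :=
    ⟨Lp.aestronglyMeasurable _, hle.trans_lt (ENNReal.rpow_lt_top_of_nonneg (by norm_num)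
      (ENNReal.mul_ne_top ENNReal.coe_ne_top ENNReal.ofReal_ne_top))⟩
  refine ⟨hmem, ?_⟩
  rw [one_div, ENNReal.le_rpow_inv_iff (by norm_num), ENNReal.rpow_two] at hle
  have := ENNReal.toReal_mono (ENNReal.mul_ne_top ENNReal.coe_ne_top ENNReal.ofReal_ne_top) hle
  rwa [ENNReal.toReal_pow, ENNReal.toReal_mul, ENNReal.toReal_ofReal (by positivity),
    ENNReal.coe_toReal] at this

theorem memLp_four_field (v : V Ω) : MemLp (field v) 4 (volume.restrict Ω) := by
  obtain ⟨C, -, h⟩ := exists_ladyzhenskaya Ω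
  exact (h v).1

theorem integrable_formB (u v w : V Ω) :
    Integrable (fun x => ∑ i, ∑ j, field u x j * grad v x (i, j) * field w x i)
      (volume.restrict Ω) :=
  (integrable_trilinear (memLp_four_field u) (memLp_four_field w) (Lp.memLp (grad v))).1

theorem abs_formB_le (u v w : V Ω) :
    |formB u v w| ≤ (eLpNorm (field u) 4 (volume.restrict Ω)).toReal *
      (eLpNorm (field w) 4 (volume.restrict Ω)).toReal * ‖grad v‖ :=
  (integrable_trilinear (memLp_four_field u) (memLp_four_field w) (Lp.memLp (grad v))).2

theorem formB_sub_left (u u' v w : V Ω) : formB (u - u') v w = formB u v w - formB u' v w := by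
  unfold formB
  rw [← integral_sub (integrable_formB u v w) (integrable_formB u' v w)]
  have h : field (u - u') = field u - field u' := map_sub (fieldL Ω) u u'
  refine integral_congr_ae ?_
  filter_upwards [Lp.coeFn_sub (field u) (field u')] with x hx
  simp only [h, hx, Pi.sub_apply, PiLp.sub_apply, sub_mul, Finset.sum_sub_distrib]

theorem formB_sub_middle (u v v' w : V Ω) : formB u (v - v') w = formB u v w - formB u v' w := by
  unfold formB
  rw [← integral_sub (integrable_formB u v w) (integrable_formB u v' w)]
  have h : grad (v - v') = grad v - grad v' := map_sub (gradL Ω) v v'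
  refine integral_congr_ae ?_
  filter_upwards [Lp.coeFn_sub (grad v) (grad v')] with x hx
  simp only [h, hx, Pi.sub_apply, PiLp.sub_apply, mul_sub, sub_mul, Finset.sum_sub_distrib]

theorem formB_sub_right (u v w w' : V Ω) : formB u v (w - w') = formB u v w - formB u v w' := by
  unfold formB
  rw [← integral_sub (integrable_formB u v w) (integrable_formB u v w')]
  have h : field (w - w') = field w - field w' := map_sub (fieldL Ω) w w'
  refine integral_congr_ae ?_
  filter_upwards [Lp.coeFn_sub (field w) (field w')] with x hx
  simp only [h, hx, Pi.sub_apply, PiLp.sub_apply, mul_sub, Finset.sum_sub_distrib]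

theorem exists_formB_bound (Ω : Set (E 2)) : ∃ C : ℝ, 0 ≤ C ∧ ∀ u v w : V Ω,
    |formB u v w| ≤ C * ‖u‖ * ‖v‖ * ‖w‖ := by
  obtain ⟨C, hC0, hC⟩ := exists_ladyzhenskaya Ω
  have h4 : ∀ v : V Ω, (eLpNorm (field v) 4 (volume.restrict Ω)).toReal ≤ √C * ‖v‖ := by
    intro v
    refine abs_le_of_sq_le_sq' ?_ (by positivity) |>.2
    rw [mul_pow, Real.sq_sqrt hC0, sq ‖v‖]
    exact (hC v).2.trans (by gcongr; exacts [norm_field_le v, norm_grad_le v])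
  refine ⟨C, hC0, fun u v w => (abs_formB_le u v w).trans ?_⟩
  calc _ ≤ (√C * ‖u‖) * (√C * ‖w‖) * ‖v‖ := by gcongr; exacts [h4 u, h4 w, norm_grad_le v]
    _ = (√C * √C) * ‖u‖ * ‖v‖ * ‖w‖ := by ring
    _ = _ := by rw [Real.mul_self_sqrt hC0]

/-- Change one slot at a time and apply the trilinear bound to each difference. -/
theorem tendsto_formB {a b c : ℕ → V Ω} {u v w : V Ω} (ha : Tendsto a atTop (𝓝 u))
    (hb : Tendsto b atTop (𝓝 v)) (hc : Tendsto c atTop (𝓝 w)) :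
    Tendsto (fun n => formB (a n) (b n) (c n)) atTop (𝓝 (formB u v w)) := by
  obtain ⟨C, hC0, hC⟩ := exists_formB_bound Ω
  rw [tendsto_iff_norm_sub_tendsto_zero]
  have hlim : Tendsto (fun n => C * ‖a n - u‖ * ‖b n‖ * ‖c n‖ + C * ‖u‖ * ‖b n - v‖ * ‖c n‖ +
      C * ‖u‖ * ‖v‖ * ‖c n - w‖) atTop (𝓝 (C * ‖u - u‖ * ‖v‖ * ‖w‖ + C * ‖u‖ * ‖v - v‖ * ‖w‖ +
      C * ‖u‖ * ‖v‖ * ‖w - w‖)) := by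
    have h1 := (ha.sub_const u).norm
    have h2 := (hb.sub_const v).norm
    have h3 := (hc.sub_const w).norm
    exact (((h1.const_mul C).mul hb.norm).mul hc.norm).add
      ((h2.const_mul (C * ‖u‖)).mul hc.norm) |>.add (h3.const_mul (C * ‖u‖ * ‖v‖))
  simp only [sub_self, norm_zero, mul_zero, zero_mul, add_zero] at hlim
  refine squeeze_zero (fun _ => norm_nonneg _) (fun n => ?_) hlim
  have e : formB (a n) (b n) (c n) - formB u v w =
      formB (a n - u) (b n) (c n) + formB u (b n - v) (c n) + formB u v (c n - w) := by
    rw [formB_sub_left, formB_sub_middle, formB_sub_right]; ring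
  rw [e]
  refine (norm_add₃_le).trans ?_
  gcongr
  exacts [hC _ _ _, hC _ _ _, hC _ _ _]

theorem formB_self_antisymm (u v : V Ω) : formB u u v = -formB u v u := by
  obtain ⟨a, φ, hφ, ha⟩ := exists_seq_represents u
  obtain ⟨b, ψ, hψ, hb⟩ := exists_seq_represents v
  refine tendsto_nhds_unique (tendsto_formB ha ha hb) ?_
  simp only [fun n => formB_self_antisymm_of_represents (hφ n) (hψ n)]
  exact (tendsto_formB ha hb ha).neg

theorem formB_self_self (u : V Ω) : formB u u u = 0 := by
  have := formB_self_antisymm u u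
  linarith

/-- The convective term, as a functional, is controlled by the energy and the dissipation. -/
theorem exists_abs_formB_self_le (Ω : Set (E 2)) : ∃ C : ℝ, 0 ≤ C ∧ ∀ u v : V Ω,
    |formB u u v| ≤ C * ‖field u‖ * ‖grad u‖ * ‖v‖ := by
  obtain ⟨C, hC0, hC⟩ := exists_ladyzhenskaya Ω
  refine ⟨C, hC0, fun u v => ?_⟩
  -- Moving the derivative onto v leaves two factors u in L⁴, whose product costs only one power of
  -- ‖∇u‖. This is what makes b(u,u,·) square integrable in time.
  rw [formB_self_antisymm, abs_neg]
  refine (abs_formB_le u v u).trans ?_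
  rw [← sq, mul_assoc C]
  gcongr
  exacts [(hC u).2, norm_grad_le v]

end Planar

/-! ### Distributional derivatives in time -/

section WeakDerivative

theorem exists_Ioo_of_isCompact_subset_Ioi {K : Set ℝ} (hK : IsCompact K) (hs : K ⊆ Ioi 0) :
    ∃ a b : ℝ, 0 < a ∧ a < b ∧ K ⊆ Ioo a b := by
  rcases K.eq_empty_or_nonempty with rfl | hne
  · exact ⟨1, 2, by norm_num, by norm_num, empty_subset _⟩
  · have h1 : 0 < sInf K := hs (hK.sInf_mem hne)
    have h2 : ∀ x ∈ K, sInf K ≤ x ∧ x ≤ sSup K := fun x hx =>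
      ⟨csInf_le hK.bddBelow hx, le_csSup hK.bddAbove hx⟩
    obtain ⟨x, hx⟩ := hne
    refine ⟨sInf K / 2, sSup K + 1, by linarith, ?_, fun x hx => ⟨?_, ?_⟩⟩
    all_goals have := h2 x hx; linarith

theorem setIntegral_Ioi_eq_intervalIntegral {F : ℝ → ℝ} {a b : ℝ} (ha : 0 < a) (hab : a ≤ b)
    (hF : ∀ x, x ∉ Ioo a b → F x = 0) : ∫ x in Ioi 0, F x = ∫ x in a..b, F x := by
  rw [intervalIntegral.integral_of_le hab]
  exact setIntegral_eq_of_subset_of_forall_sdiff_eq_zero measurableSet_Ioi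
    (fun x hx => ha.trans hx.1) fun x hx => hF x fun h => hx.2 ⟨h.1, h.2.le⟩

theorem integral_eq_intervalIntegral_of_eq_zero {F : ℝ → ℝ} {a b : ℝ} (hab : a ≤ b)
    (hF : ∀ x, x ∉ Ioo a b → F x = 0) : ∫ x, F x = ∫ x in a..b, F x := by
  rw [intervalIntegral.integral_of_le hab]
  exact (setIntegral_eq_integral_of_forall_compl_eq_zero (s := Ioc a b) (f := F)
    fun x hx => hF x fun h => hx (Ioo_subset_Ioc_self h)).symm

/-- A smooth function of integral zero, supported in `(a, b)`, is the derivative of a smooth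
function supported in `[a, b]`. -/
theorem exists_smooth_primitive {η : ℝ → ℝ} (hη : ContDiff ℝ ∞ η) {a b : ℝ}
    (hs : ∀ x, x ∉ Ioo a b → η x = 0) (h0 : ∫ x in a..b, η x = 0) :
    ∃ θ : ℝ → ℝ, ContDiff ℝ ∞ θ ∧ deriv θ = η ∧ ∀ x, x ∉ Ioo a b → θ x = 0 := by
  have hd : ∀ x, HasDerivAt (fun x => ∫ t in a..x, η t) (η x) x := fun x =>
    intervalIntegral.integral_hasDerivAt_right (hη.continuous.intervalIntegrable _ _)
      hη.continuous.stronglyMeasurable.stronglyMeasurableAtFilter hη.continuous.continuousAt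
  have hd' : deriv (fun x => ∫ t in a..x, η t) = η := funext fun x => (hd x).deriv
  refine ⟨fun x => ∫ t in a..x, η t, ?_, hd', fun x hx => ?_⟩
  · rw [contDiff_infty_iff_deriv, hd']
    exact ⟨fun x => (hd x).differentiableAt, hη⟩
  · rcases le_or_gt x a with h | h
    · refine intervalIntegral.integral_zero_ae (.of_forall fun t ht => hs t fun h' => ?_)
      rw [uIoc_of_ge h] at ht
      exact absurd h'.1 (not_lt.2 ht.2)
    · have hb : b ≤ x := not_lt.1 fun h' => hx ⟨h, h'⟩
      change ∫ t in a..x, η t = 0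
      rw [← intervalIntegral.integral_add_adjacent_intervals
        (hη.continuous.intervalIntegrable a b) (hη.continuous.intervalIntegrable b x), h0, zero_add]
      refine intervalIntegral.integral_zero_ae (.of_forall fun t ht => hs t fun h' => ?_)
      rw [uIoc_of_le hb] at ht
      exact absurd h'.2 (not_lt.2 ht.1.le)

theorem compact_tsupport_of_eq_zero {θ : ℝ → ℝ} {a b : ℝ} (ha : 0 < a)
    (hs : ∀ x, x ∉ Ioo a b → θ x = 0) : HasCompactSupport θ ∧ tsupport θ ⊆ Ioi 0 := by
  have h1 : tsupport θ ⊆ Icc a b := closure_minimal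
    (fun x hx => by
      by_contra h
      exact hx (hs x fun h' => h ⟨h'.1.le, h'.2.le⟩)) isClosed_Icc
  exact ⟨isCompact_Icc.of_isClosed_subset (isClosed_tsupport θ) h1,
    h1.trans fun x hx => ha.trans_le hx.1⟩

/-- A continuous function on `(0, ∞)` whose distributional derivative vanishes is constant. -/
theorem exists_eq_const_of_weakDeriv_zero {W : ℝ → ℝ} (hW : ContinuousOn W (Ioi 0))
    (h : ∀ θ : ℝ → ℝ, ContDiff ℝ ∞ θ → HasCompactSupport θ → tsupport θ ⊆ Ioi 0 →
      ∫ t in Ioi (0 : ℝ), deriv θ t * W t = 0) : ∃ c, ∀ t ∈ Ioi (0 : ℝ), W t = c := by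
  -- A fixed bump of integral one supported in [1/2, 3/2]. The constant is the mean of W against it.
  let B : ContDiffBump (1 : ℝ) := ⟨1 / 4, 1 / 2, by norm_num, by norm_num⟩
  set ρ : ℝ → ℝ := B.normed volume with hρ
  have hρc : ContDiff ℝ ∞ ρ := B.contDiff_normed
  have hρs : tsupport ρ ⊆ Ioi 0 := by
    rw [hρ, B.tsupport_normed_eq, Real.closedBall_eq_Icc]
    intro x hx
    have : (1 : ℝ) - 1 / 2 ≤ x := hx.1
    exact lt_of_lt_of_le (by norm_num) this
  have hρk : HasCompactSupport ρ := B.hasCompactSupport_normed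
  have hρ1 : ∫ x, ρ x = 1 := B.integral_normed
  set c := ∫ x in Ioi 0, ρ x * W x with hc
  have hae : ∀ᵐ x, x ∈ Ioi (0 : ℝ) → W x - c = 0 := by
    refine isOpen_Ioi.ae_eq_zero_of_integral_contDiff_smul_eq_zero
      ((hW.sub continuousOn_const).locallyIntegrableOn measurableSet_Ioi) fun ψ hψ hψk hψs => ?_
    obtain ⟨a, b, ha, hab, hK⟩ := exists_Ioo_of_isCompact_subset_Ioi
      (hρk.isCompact.union hψk.isCompact) (union_subset hρs hψs)
    have zρ : ∀ x, x ∉ Ioo a b → ρ x = 0 := fun x hx =>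
      image_eq_zero_of_notMem_tsupport fun h => hx (hK (Or.inl h))
    have zψ : ∀ x, x ∉ Ioo a b → ψ x = 0 := fun x hx =>
      image_eq_zero_of_notMem_tsupport fun h => hx (hK (Or.inr h))
    have hWab : ContinuousOn W (uIcc a b) := by
      rw [uIcc_of_le hab.le]
      exact hW.mono fun x hx => ha.trans_le hx.1
    have iψ := hψ.continuous.intervalIntegrable (μ := volume) a b
    have iρ := hρc.continuous.intervalIntegrable (μ := volume) a b
    have iψW : IntervalIntegrable (fun x => ψ x * W x) volume a b :=
      (hψ.continuous.continuousOn.mul hWab).intervalIntegrable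
    have iρW : IntervalIntegrable (fun x => ρ x * W x) volume a b :=
      (hρc.continuous.continuousOn.mul hWab).intervalIntegrable
    set m := ∫ x in a..b, ψ x with hm
    have hρ1' : ∫ x in a..b, ρ x = 1 := by
      rw [← hρ1, integral_eq_intervalIntegral_of_eq_zero hab.le zρ]
    have hc' : c = ∫ x in a..b, ρ x * W x :=
      setIntegral_Ioi_eq_intervalIntegral ha hab.le fun x hx => by rw [zρ x hx, zero_mul]
    -- Subtracting (∫ψ)ρ from an arbitrary test function ψ makes its integral vanish, so the
    -- difference is the derivative of a test function and the hypothesis applies.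
    obtain ⟨θ, hθ, hθd, zθ⟩ := exists_smooth_primitive (η := fun x => ψ x - m * ρ x)
      (hψ.sub (contDiff_const.mul hρc)) (fun x hx => by simp [zψ x hx, zρ x hx]) (by
        rw [intervalIntegral.integral_sub iψ (iρ.const_mul m),
          intervalIntegral.integral_const_mul, hρ1']
        simp [hm])
    obtain ⟨hθk, hθs⟩ := compact_tsupport_of_eq_zero ha zθ
    have key := h θ hθ hθk hθs
    rw [hθd, setIntegral_Ioi_eq_intervalIntegral ha hab.le
      (fun x hx => by simp [zψ x hx, zρ x hx])] at key
    have e1 : ∫ x in a..b, (ψ x - m * ρ x) * W x = (∫ x in a..b, ψ x * W x) - m * c := by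
      rw [hc', ← intervalIntegral.integral_const_mul,
        ← intervalIntegral.integral_sub iψW (iρW.const_mul m)]
      congr 1; ext x; ring
    rw [e1] at key
    rw [integral_eq_intervalIntegral_of_eq_zero hab.le (fun x hx => by simp [zψ x hx])]
    simp only [smul_eq_mul, mul_sub]
    rw [intervalIntegral.integral_sub iψW (iψ.mul_const c), intervalIntegral.integral_mul_const]
    exact key
  refine ⟨c, ?_⟩
  have : EqOn W (fun _ => c) (Ioi 0) := by
    refine Measure.eqOn_open_of_ae_eq (μ := volume) ?_ isOpen_Ioi hW continuousOn_const
    rw [EventuallyEq, ae_restrict_iff' measurableSet_Ioi]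
    filter_upwards [hae] with x hx h'
    exact sub_eq_zero.1 (hx h')
  exact this

/-- A continuous function on `(0, ∞)` with a locally integrable distributional derivative is a
primitive of that derivative. -/
theorem sub_eq_integral_of_weakDeriv {w k : ℝ → ℝ} (hw : ContinuousOn w (Ioi 0))
    (hk : ∀ ε T : ℝ, 0 < ε → ε < T → IntegrableOn k (Icc ε T))
    (h : ∀ θ : ℝ → ℝ, ContDiff ℝ ∞ θ → HasCompactSupport θ → tsupport θ ⊆ Ioi 0 →
      ∫ t in Ioi (0 : ℝ), deriv θ t * w t = -∫ t in Ioi (0 : ℝ), θ t * k t)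
    {s t : ℝ} (hs : 0 < s) (ht : 0 < t) : w t - w s = ∫ τ in s..t, k τ := by
  have hki : ∀ {x y : ℝ}, 0 < x → 0 < y → IntervalIntegrable k volume x y := by
    intro x y hx hy
    rw [intervalIntegrable_iff]
    refine (hk (min x y / 2) (max x y) (by positivity) ?_).mono_set ?_
    · have : 0 < min x y := by positivity
      have : min x y ≤ max x y := min_le_max
      linarith
    · have : 0 < min x y := by positivity
      exact fun z hz => ⟨by linarith [hz.1.le], hz.2⟩
  set K : ℝ → ℝ := fun t => ∫ τ in (1 : ℝ)..t, k τ with hK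
  have hKac : ∀ {a b : ℝ}, 0 < a → a ≤ b → AbsolutelyContinuousOnInterval K a b := by
    intro a b ha hab
    have : AbsolutelyContinuousOnInterval K (min a 1) (max b 1) := by
      refine (hki (by positivity) (by positivity)).absolutelyContinuousOnInterval_intervalIntegral ?_
      rw [uIcc_of_le ((min_le_right _ _).trans (le_max_right _ _))]
      exact ⟨min_le_right _ _, le_max_right _ _⟩
    refine this.mono ?_
    rw [uIcc_of_le hab, uIcc_of_le ((min_le_right _ _).trans (le_max_right _ _))]
    exact Icc_subset_Icc (min_le_left _ _) (le_max_left _ _)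
  have hKc : ContinuousOn K (Ioi 0) := by
    intro x hx
    have hx' : 0 < x := hx
    have := (hKac (a := x / 2) (b := 2 * x) (by linarith) (by linarith)).continuousOn
    rw [uIcc_of_le (by linarith)] at this
    exact (this.continuousAt (Icc_mem_nhds (by linarith) (by linarith))).continuousWithinAt
  -- Integration by parts for absolutely continuous functions shows that the primitive K has weak
  -- derivative k, so w - K has weak derivative zero.
  obtain ⟨c, hc⟩ := exists_eq_const_of_weakDeriv_zero (W := fun t => w t - K t) (hw.sub hKc) (by
    intro θ hθ hθk hθs
    obtain ⟨a, b, ha, hab, hsub⟩ := exists_Ioo_of_isCompact_subset_Ioi hθk.isCompact hθs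
    have zθ : ∀ x, x ∉ Ioo a b → θ x = 0 := fun x hx =>
      image_eq_zero_of_notMem_tsupport fun h => hx (hsub h)
    have zθ' : ∀ x, x ∉ Ioo a b → deriv θ x = 0 := fun x hx =>
      image_eq_zero_of_notMem_tsupport fun h => hx (hsub (tsupport_deriv_subset h))
    have h1 := h θ hθ hθk hθs
    rw [setIntegral_Ioi_eq_intervalIntegral ha hab.le (fun x hx => by rw [zθ' x hx, zero_mul]),
      setIntegral_Ioi_eq_intervalIntegral ha hab.le (fun x hx => by rw [zθ x hx, zero_mul])] at h1
    rw [setIntegral_Ioi_eq_intervalIntegral ha hab.le (fun x hx => by rw [zθ' x hx, zero_mul])]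
    have hθac : AbsolutelyContinuousOnInterval θ a b :=
      (hθ.contDiffOn.of_le (by simp)).absolutelyContinuousOnInterval
    have h2 := hθac.integral_mul_deriv_eq_deriv_mul (hKac ha hab.le)
    rw [zθ a (by simp), zθ b (by simp), zero_mul, zero_mul, sub_zero, zero_sub] at h2
    have h3 : ∫ x in a..b, θ x * deriv K x = ∫ x in a..b, θ x * k x := by
      refine intervalIntegral.integral_congr_ae ?_
      have hle : min a 1 ≤ max b 1 := (min_le_right _ _).trans (le_max_right _ _)
      filter_upwards [(hki (x := min a 1) (y := max b 1)
        (by positivity) (by positivity)).ae_hasDerivAt_integral] with x hx hxab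
      rw [uIoc_of_le hab.le] at hxab
      have hx' : x ∈ uIcc (min a 1) (max b 1) := by
        rw [uIcc_of_le hle]
        exact ⟨(min_le_left _ _).trans hxab.1.le, hxab.2.trans (le_max_left _ _)⟩
      have h1' : (1 : ℝ) ∈ uIcc (min a 1) (max b 1) := by
        rw [uIcc_of_le hle]
        exact ⟨min_le_right _ _, le_max_right _ _⟩
      have hd : HasDerivAt K (k x) x := hx hx' 1 h1'
      rw [hd.deriv]
    have cθ : ContinuousOn (deriv θ) (uIcc a b) :=
      (hθ.continuous_deriv (by simp)).continuousOn
    have hsubI : uIcc a b ⊆ Ioi 0 := by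
      rw [uIcc_of_le hab.le]; exact fun x hx => ha.trans_le hx.1
    simp only [mul_sub]
    have i1 : IntervalIntegrable (fun x => deriv θ x * w x) volume a b :=
      (cθ.mul (hw.mono hsubI)).intervalIntegrable
    have i2 : IntervalIntegrable (fun x => deriv θ x * K x) volume a b :=
      (cθ.mul (hKc.mono hsubI)).intervalIntegrable
    rw [intervalIntegral.integral_sub i1 i2, h1, ← h3, h2]
    ring)
  have h1 := hc s hs
  have h2 := hc t ht
  have h3 : (∫ τ in (1 : ℝ)..t, k τ) - ∫ τ in (1 : ℝ)..s, k τ = ∫ τ in s..t, k τ :=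
    intervalIntegral.integral_interval_sub_left (hki one_pos ht) (hki one_pos hs)
  rw [← h3]
  simp only [hK] at h1 h2
  linarith

end WeakDerivative

/-! ### An energy inequality for evolutions in a Gelfand triple -/

section EvolutionTriple

variable {W : Type*} [NormedAddCommGroup W] [NormedSpace ℝ W]

/-- The duality pairing of `L²` functions depends continuously on a translation of one of them. -/
theorem continuous_integral_translate {g : ℝ → W →L[ℝ] ℝ} {U : ℝ → W} (hg : MemLp g 2 volume)
    (hU : MemLp U 2 volume) : Continuous fun η : ℝ => ∫ r, g (r - η) (U r) := by
  -- Translations form a continuous family in C(ℝ, ℝ); this gives continuity of translation in L².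
  let T : ℝ → C(ℝ, ℝ) := fun η =>
    (ContinuousMap.mk (fun p : ℝ × ℝ => p.2 - p.1) (by fun_prop)).curry η
  have hT : Continuous T := ContinuousMap.continuous _
  have hTm : ∀ η, MeasurePreserving (T η) volume volume := fun η =>
    measurePreserving_sub_right volume η
  have hcont : Continuous fun η => Lp.compMeasurePreserving (T η) (hTm η) (hg.toLp g) :=
    continuous_const.compMeasurePreservingLp hT hTm (by simp)
  have h2 := ((ContinuousLinearMap.id ℝ (W →L[ℝ] ℝ)).lpPairing volume 2 2).flip
    (hU.toLp U) |>.continuous.comp hcont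
  refine h2.congr fun η => ?_
  change (ContinuousLinearMap.id ℝ (W →L[ℝ] ℝ)).lpPairing volume 2 2 _ _ = _
  rw [ContinuousLinearMap.lpPairing_eq_integral]
  refine integral_congr_ae ?_
  filter_upwards [Lp.coeFn_compMeasurePreserving (hg.toLp g) (hTm η), hU.coeFn_toLp,
    (hTm η).quasiMeasurePreserving.ae hg.coeFn_toLp] with r h1 h3 h4
  rw [h1, h3, Function.comp_apply, h4]
  rfl

/-- Joint integrability for the later use of Fubini. The pairing is dominated by ‖g‖² + ‖U‖²;
measurability and integrability of the translated factor come from the convolution integrand with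
the constant 1. -/
theorem integrable_translate_prod {g : ℝ → W →L[ℝ] ℝ} {U : ℝ → W} (hg : MemLp g 2 volume)
    (hU : MemLp U 2 volume) (h : ℝ) :
    Integrable (fun p : ℝ × ℝ => g (p.1 - p.2) (U p.1))
      (volume.prod (volume.restrict (Ioc 0 h))) := by
  have hone : Integrable (fun _ : ℝ => (1 : ℝ)) (volume.restrict (Ioc 0 h)) := integrable_const 1
  have hgm : AEStronglyMeasurable (fun p : ℝ × ℝ => g (p.1 - p.2))
      (volume.prod (volume.restrict (Ioc 0 h))) := by
    simpa using! hone.1.convolution_integrand (ContinuousLinearMap.lsmul ℝ ℝ) hg.1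
  have hUm : AEStronglyMeasurable (fun p : ℝ × ℝ => U p.1)
      (volume.prod (volume.restrict (Ioc 0 h))) := hU.1.comp_fst
  have i1 : Integrable (fun p : ℝ × ℝ => ‖g (p.1 - p.2)‖ ^ 2)
      (volume.prod (volume.restrict (Ioc 0 h))) := by
    simpa using! hone.convolution_integrand (ContinuousLinearMap.lsmul ℝ ℝ)
      (hg.integrable_norm_pow (by simp))
  have i2 : Integrable (fun p : ℝ × ℝ => ‖U p.1‖ ^ 2)
      (volume.prod (volume.restrict (Ioc 0 h))) :=
    (hU.integrable_norm_pow (by simp)).comp_fst _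
  refine (i1.add i2).mono' ?_ (.of_forall fun p => ?_)
  · exact (ContinuousLinearMap.id ℝ (W →L[ℝ] ℝ)).aestronglyMeasurable_comp₂ hgm hUm
  · refine ((g (p.1 - p.2)).le_opNorm _).trans ?_
    simp only [Pi.add_apply]
    nlinarith [sq_nonneg (‖g (p.1 - p.2)‖ - ‖U p.1‖), norm_nonneg (g (p.1 - p.2)),
      norm_nonneg (U p.1), mul_nonneg (norm_nonneg (g (p.1 - p.2))) (norm_nonneg (U p.1))]

theorem exists_memLp_extension {F : Type*} [NormedAddCommGroup F] {s : Set ℝ}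
    (hs : MeasurableSet s) {f : ℝ → F} (hf : MemLp f 2 (volume.restrict s)) :
    ∃ f' : ℝ → F, MemLp f' 2 volume ∧ (∀ r ∈ s, f' r = f r) ∧ ∀ r ∉ s, f' r = 0 :=
  ⟨s.indicator f, (memLp_indicator_iff_restrict hs).2 hf,
    fun _ hr => indicator_of_mem hr f, fun _ hr => indicator_of_notMem hr f⟩

variable {X : Type*} [NormedAddCommGroup X] [InnerProductSpace ℝ X]

/-- The energy inequality for a weakly continuous function in a Gelfand triple, whose time
derivative is square integrable with values in the dual space. -/
theorem energy_inequality_of_evolution {a b : ℝ} {u : ℝ → X} {U : ℝ → W}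
    {g : ℝ → W →L[ℝ] ℝ} (i : W →L[ℝ] X)
    (hU : MemLp U 2 (volume.restrict (Icc a b))) (hg : MemLp g 2 (volume.restrict (Icc a b)))
    (hiU : ∀ᵐ t, t ∈ Icc a b → u t = i (U t))
    (hev : ∀ v, ∀ s ∈ Icc a b, ∀ t ∈ Icc a b,
      inner ℝ (u t) (i v) - inner ℝ (u s) (i v) = ∫ τ in s..t, g τ v)
    (hw : ∀ t ∈ Icc a b, ContinuousOn (fun τ => (inner ℝ (u τ) (u t) : ℝ)) (Icc a b)) :
    ∀ᵐ s, s ∈ Ioo a b → ∀ t ∈ Icc s b,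
      ‖u t‖ ^ 2 ≤ ‖u s‖ ^ 2 + 2 * ∫ τ in s..t, g τ (U τ) := by
  rcases le_or_gt b a with hba | hab
  · exact .of_forall fun s hs => absurd (hs.1.trans hs.2) (not_lt.2 hba)
  set y : ℝ → ℝ := fun t => ‖u t‖ ^ 2 with hy
  have hyint : IntegrableOn y (Icc a b) := by
    have h1 : IntegrableOn (fun t => ‖i (U t)‖ ^ 2) (Icc a b) :=
      (i.comp_memLp' hU).integrable_norm_pow (by simp)
    refine h1.congr ?_
    rw [EventuallyEq, ae_restrict_iff' measurableSet_Icc]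
    filter_upwards [hiU] with t ht h'
    simp only [hy, ht h']
  have hyI : ∀ {p q : ℝ}, p ∈ Icc a b → q ∈ Icc a b → IntervalIntegrable y volume p q := by
    intro p q hp hq
    exact (intervalIntegrable_iff.2 (hyint.mono_set
      (uIoc_subset_uIcc.trans (uIcc_subset_Icc hp hq))))
  have haI : a ∈ Icc a b := left_mem_Icc.2 hab.le
  have hbI : b ∈ Icc a b := right_mem_Icc.2 hab.le
  filter_upwards [(hyI haI hbI).ae_hasDerivAt_integral] with s hsd hs t ht
  have hsI : s ∈ Icc a b := Ioo_subset_Icc_self hs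
  have htI : t ∈ Icc a b := ⟨hs.1.le.trans ht.1, ht.2⟩
  rcases ht.1.eq_or_lt with rfl | hst
  · simp
  have hsub : Ioc s t ⊆ Icc a b := fun r hr => ⟨hs.1.le.trans hr.1.le, hr.2.trans ht.2⟩
  -- Extension by zero puts both factors in L²(ℝ), where translation is continuous. Shifts η ≤ h < s
  -- - a keep r - η inside [a, b], so the extension of g is invisible below.
  obtain ⟨gt, hgt2, hgt⟩ := exists_memLp_extension measurableSet_Icc hg
  obtain ⟨Us, hUs2, hUs⟩ := exists_memLp_extension (s := Ioc s t) measurableSet_Ioc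
    (hU.mono_measure (Measure.restrict_mono hsub le_rfl))
  set D : ℝ → ℝ := fun η => ∫ r, gt (r - η) (Us r) with hD
  have hDc : Continuous D := continuous_integral_translate hgt2 hUs2
  have hD0 : D 0 = ∫ τ in s..t, g τ (U τ) := by
    rw [intervalIntegral.integral_of_le hst.le, ← integral_indicator measurableSet_Ioc]
    refine integral_congr_ae (.of_forall fun r => ?_)
    by_cases hr : r ∈ Ioc s t
    · have : r ∈ Icc a b := ⟨hs.1.le.trans hr.1.le, hr.2.trans ht.2⟩
      simp [hgt.1 r this, hUs.1 r hr, hr]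
    · simp [hUs.2 r hr, hr]
  -- From ‖u(r) - u(r-h)‖² ≥ 0 follows y(r) - y(r-h) ≤ 2⟨u(r) - u(r-h), u(r)⟩, which for almost
  -- every r is 2∫_{r-h}^r ⟨g(τ), U(r)⟩ dτ. Integrating over r ∈ (s, t) telescopes the left side,
  -- and Fubini turns the right side into 2∫_0^h D.
  have hmain : ∀ h, 0 < h → h < s - a →
      (∫ r in (t - h)..t, y r) - ∫ r in (s - h)..s, y r ≤ 2 * ∫ η in (0 : ℝ)..h, D η := by
    intro h h0 h1
    have hprod := integrable_translate_prod hgt2 hUs2 h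
    have hswap : ∫ η in (0 : ℝ)..h, D η = ∫ r, ∫ η in Ioc 0 h, gt (r - η) (Us r) := by
      rw [intervalIntegral.integral_of_le h0.le]
      exact (integral_integral_swap hprod).symm
    have hshI : s - h ∈ Icc a b := ⟨by linarith, by linarith [hsI.2]⟩
    have hthI : t - h ∈ Icc a b := ⟨by linarith, by linarith [htI.2]⟩
    have hshift : IntervalIntegrable (fun r => y (r - h)) volume s t := by
      simpa using (hyI hshI hthI).comp_sub_right h
    have hlhs : (∫ r in (t - h)..t, y r) - ∫ r in (s - h)..s, y r =
        ∫ r in s..t, (y r - y (r - h)) := by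
      rw [intervalIntegral.integral_sub (hyI hsI htI) hshift,
        intervalIntegral.integral_comp_sub_right]
      have e1 := intervalIntegral.integral_add_adjacent_intervals (hyI hshI hthI) (hyI hthI htI)
      have e2 := intervalIntegral.integral_add_adjacent_intervals (hyI hshI hsI) (hyI hsI htI)
      linarith
    rw [hlhs, hswap]
    have hpt : ∀ᵐ r, r ∈ Ioc s t →
        y r - y (r - h) ≤ 2 * ∫ η in Ioc 0 h, gt (r - η) (Us r) := by
      filter_upwards [hiU] with r hr hrI
      have hrab : r ∈ Icc a b := ⟨hs.1.le.trans hrI.1.le, hrI.2.trans ht.2⟩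
      have hrhab : r - h ∈ Icc a b := ⟨by linarith [hrI.1], by linarith [hrab.2]⟩
      have e1 : ∫ η in Ioc 0 h, gt (r - η) (Us r) = ∫ τ in (r - h)..r, g τ (U r) := by
        have := intervalIntegral.integral_comp_sub_left (a := 0) (b := h)
          (fun τ => g τ (U r)) r
        rw [sub_zero] at this
        rw [← this, intervalIntegral.integral_of_le h0.le]
        refine setIntegral_congr_fun measurableSet_Ioc fun η hη => ?_
        have h3 : r - η ∈ Icc a b := ⟨by linarith [hη.2, hrI.1], by linarith [hη.1, hrab.2]⟩
        simp only [hgt.1 _ h3, hUs.1 r hrI]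
      rw [e1, ← hev (U r) _ hrhab _ hrab, ← hr hrab, real_inner_self_eq_norm_sq]
      have h4 := norm_sub_sq_real (u (r - h)) (u r)
      have h5 := sq_nonneg ‖u (r - h) - u r‖
      simp only [hy]
      linarith
    have hint2 : IntervalIntegrable (fun r => 2 * ∫ η in Ioc 0 h, gt (r - η) (Us r)) volume s t :=
      (hprod.integral_prod_left.const_mul 2).intervalIntegrable
    calc ∫ r in s..t, (y r - y (r - h)) ≤ ∫ r in s..t, 2 * ∫ η in Ioc 0 h, gt (r - η) (Us r) := by
          refine intervalIntegral.integral_mono_ae_restrict hst.le ((hyI hsI htI).sub hshift) hint2 ?_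
          rw [← restrict_Ioc_eq_restrict_Icc]
          exact (ae_restrict_iff' measurableSet_Ioc).2 hpt
      _ = 2 * ∫ r, ∫ η in Ioc 0 h, gt (r - η) (Us r) := by
          rw [intervalIntegral.integral_const_mul, intervalIntegral.integral_of_le hst.le]
          congr 1
          refine setIntegral_eq_integral_of_forall_compl_eq_zero fun r hr => ?_
          simp [hUs, hr]
  refine le_of_forall_pos_le_add fun ε hε => ?_
  have ev1 : ∀ᶠ h in 𝓝[>] (0 : ℝ), h < s - a :=
    (eventually_lt_nhds (sub_pos.2 hs.1)).filter_mono nhdsWithin_le_nhds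
  have ev0 : ∀ᶠ h in 𝓝[>] (0 : ℝ), 0 < h := self_mem_nhdsWithin
  -- lower semicontinuity at the final time
  have evA : ∀ᶠ h in 𝓝[>] (0 : ℝ), h * (y t - ε / 4) ≤ ∫ r in (t - h)..t, y r := by
    have hcw := hw t htI t htI
    have hev' : ∀ᶠ τ in 𝓝[Icc a b] t, y t - ε / 8 < inner ℝ (u τ) (u t) := by
      refine hcw.eventually (lt_mem_nhds ?_)
      change y t - ε / 8 < inner ℝ (u t) (u t)
      rw [real_inner_self_eq_norm_sq]
      simp only [hy]
      linarith
    obtain ⟨δ, hδ, hball⟩ := Metric.mem_nhdsWithin_iff.1 hev'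
    filter_upwards [ev0, ev1, (eventually_lt_nhds hδ).filter_mono nhdsWithin_le_nhds]
      with h h0 h1 h2
    have hthI : t - h ∈ Icc a b := ⟨by linarith, by linarith [htI.2]⟩
    have e : h * (y t - ε / 4) = ∫ r in (t - h)..t, (y t - ε / 4) := by
      rw [intervalIntegral.integral_const, smul_eq_mul]; ring
    rw [e]
    refine intervalIntegral.integral_mono_on (by linarith) (by simp) (hyI hthI htI) fun τ hτ => ?_
    have h3 : y t - ε / 8 < inner ℝ (u τ) (u t) := by
      refine hball ⟨?_, ⟨hthI.1.trans hτ.1, hτ.2.trans htI.2⟩⟩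
      rw [Metric.mem_ball, Real.dist_eq, abs_lt]
      constructor <;> linarith [hτ.1, hτ.2]
    have h4 := norm_sub_sq_real (u τ) (u t)
    have h5 := sq_nonneg ‖u τ - u t‖
    simp only [hy] at h3 ⊢
    linarith
  -- Here s must be a point where the primitive of y has derivative y(s). This is the only reason
  -- for excluding a null set of starting times.
  have evB : ∀ᶠ h in 𝓝[>] (0 : ℝ), ∫ r in (s - h)..s, y r ≤ h * (y s + ε / 4) := by
    have hsu : s ∈ uIcc a b := by rwa [uIcc_of_le hab.le]
    have hd : HasDerivAt (fun x => ∫ r in a..x, y r) (y s) (s - 0) := by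
      rw [sub_zero]; exact hsd hsu a left_mem_uIcc
    have hd2 : HasDerivAt (fun h => ∫ r in a..(s - h), y r) (-y s) 0 := by
      simpa using hd.comp_const_sub s 0
    have h3 := hd2.tendsto_slope_zero_right
    filter_upwards [ev0, ev1, h3.eventually (lt_mem_nhds (show -y s - ε / 4 < -y s by linarith))]
      with h h0 h1 h4
    have hshI : s - h ∈ Icc a b := ⟨by linarith, by linarith [hsI.2]⟩
    have e := intervalIntegral.integral_add_adjacent_intervals (hyI haI hshI) (hyI hshI hsI)
    rw [zero_add, sub_zero, smul_eq_mul, ← e, lt_inv_mul_iff₀ h0] at h4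
    linarith
  have evD : ∀ᶠ h in 𝓝[>] (0 : ℝ), ∫ η in (0 : ℝ)..h, D η ≤ h * (D 0 + ε / 4) := by
    have hev' : ∀ᶠ η in 𝓝 (0 : ℝ), D η < D 0 + ε / 4 :=
      hDc.continuousAt.eventually (gt_mem_nhds (by linarith))
    obtain ⟨δ, hδ, hball⟩ := Metric.mem_nhds_iff.1 hev'
    filter_upwards [ev0, (eventually_lt_nhds hδ).filter_mono nhdsWithin_le_nhds] with h h0 h2
    have e : h * (D 0 + ε / 4) = ∫ η in (0 : ℝ)..h, (D 0 + ε / 4) := by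
      rw [intervalIntegral.integral_const, smul_eq_mul, sub_zero]
    rw [e]
    refine intervalIntegral.integral_mono_on h0.le (hDc.intervalIntegrable _ _) (by simp)
      fun η hη => ?_
    refine (show D η < D 0 + ε / 4 from hball ?_).le
    rw [Metric.mem_ball, Real.dist_eq, abs_lt]
    constructor <;> linarith [hη.1, hη.2]
  obtain ⟨h, h0, h1, hA, hB, hDD⟩ := (ev0.and (ev1.and (evA.and (evB.and evD)))).exists
  have h3 := hmain h h0 h1
  have h4 : h * (y t - ε / 4) ≤ h * (y s + ε / 4 + 2 * (D 0 + ε / 4)) := by linarith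
  have h5 := le_of_mul_le_mul_left h4 h0
  rw [← hD0]
  simp only [hy] at h5
  linarith

end EvolutionTriple

/-! ### Bounds and integrability for weak solutions -/

section WeakSolution

variable {d : ℕ} {Ω : Set (E d)} {ν : ℝ → ℝ} {f : ℝ → V' Ω} {u₀ : H Ω} {u : ℝ → H Ω}
  {U : ℝ → V Ω} {g : ℝ → V' Ω}

theorem field_mem_H (v : V Ω) : field v ∈ H Ω := by
  obtain ⟨w, φ, hφ, hw⟩ := exists_seq_represents v
  refine mem_closure_of_tendsto (((fieldL Ω).continuous.tendsto v).comp hw) (.of_forall fun n => ?_)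
  exact ⟨φ n, (hφ n).1, (hφ n).2.1⟩

theorem intervalIntegrable_of_Ioo {F : ℝ → ℝ} (h : ∀ T : ℝ, 0 < T → IntegrableOn F (Ioo 0 T))
    {s t : ℝ} (hs : 0 ≤ s) (ht : 0 ≤ t) : IntervalIntegrable F volume s t := by
  rw [intervalIntegrable_iff]
  refine (h (max s t + 1) (by positivity)).mono_set fun x hx => ⟨?_, ?_⟩
  · exact (le_min hs ht).trans_lt hx.1
  · exact hx.2.trans_lt (lt_add_one _)

theorem IsWeakSolutionWith.continuousOn_inner_field (hu : IsWeakSolutionWith Ω ν f u₀ u U g)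
    (v : V Ω) : ContinuousOn (fun t => (inner ℝ (u t : L2Vec Ω) (field v) : ℝ)) (Ici 0) :=
  hu.weakCont ⟨field v, field_mem_H v⟩

/-- Weak continuity makes each pairing bounded on the compact interval; the uniform boundedness
principle makes the norms bounded. -/
theorem IsWeakSolutionWith.exists_norm_le (hu : IsWeakSolutionWith Ω ν f u₀ u U g) (T : ℝ) :
    ∃ M : ℝ, 0 ≤ M ∧ ∀ t ∈ Icc 0 T, ‖u t‖ ≤ M := by
  obtain ⟨M, hM⟩ := banach_steinhaus (g := fun t : Icc (0 : ℝ) T => innerSL ℝ (u t)) fun h => by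
    obtain ⟨C, hC⟩ := isCompact_Icc.exists_bound_of_continuousOn
      ((hu.weakCont h).mono (Icc_subset_Ici_self : Icc 0 T ⊆ Ici 0))
    exact ⟨C, fun t => hC t t.2⟩
  refine ⟨max M 0, le_max_right _ _, fun t ht => ?_⟩
  have := hM ⟨t, ht⟩
  rw [innerSL_apply_norm] at this
  exact this.trans (le_max_left _ _)

theorem IsWeakSolutionWith.inner_sub_inner_eq (hu : IsWeakSolutionWith Ω ν f u₀ u U g) (v : V Ω)
    {s t : ℝ} (hs : 0 < s) (ht : 0 < t) :
    inner ℝ (u t : L2Vec Ω) (field v) - inner ℝ (u s : L2Vec Ω) (field v) = ∫ τ in s..t, g τ v :=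
  sub_eq_integral_of_weakDeriv (w := fun t => inner ℝ (u t : L2Vec Ω) (field v))
    ((hu.continuousOn_inner_field v).mono Ioi_subset_Ici_self)
    (fun ε T hε hT => (ContinuousLinearMap.apply ℝ ℝ v).integrable_comp (hu.derivL1 ε T hε hT))
    (fun θ h1 h2 h3 => hu.isTimeDeriv θ h1 h2 h3 v) hs ht

theorem IsWeakSolutionWith.integrableOn_norm_grad_sq (hu : IsWeakSolutionWith Ω ν f u₀ u U g)
    {T : ℝ} (hT : 0 < T) : IntegrableOn (fun t => ‖grad (U t)‖ ^ 2) (Ioo 0 T) :=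
  ((gradL Ω).comp_memLp' (hu.memL2 T hT)).integrable_norm_pow (by simp)

theorem IsWeakSolutionWith.integrableOn_viscous (hu : IsWeakSolutionWith Ω ν f u₀ u U g)
    {νhigh : ℝ} (hνL1 : ∀ T : ℝ, 0 < T → IntegrableOn ν (Ioo 0 T))
    (hν : ∀ t : ℝ, 0 < t → 0 ≤ ν t ∧ ν t ≤ νhigh) {T : ℝ} (hT : 0 < T) :
    IntegrableOn (fun t => ν t * ‖grad (U t)‖ ^ 2) (Ioo 0 T) := by
  refine (hu.integrableOn_norm_grad_sq hT).bdd_mul (c := νhigh) (hνL1 T hT).1 ?_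
  refine (ae_restrict_iff' measurableSet_Ioo).2 (.of_forall fun t ht => ?_)
  rw [Real.norm_of_nonneg (hν t ht.1).1]
  exact (hν t ht.1).2

theorem IsWeakSolutionWith.integrableOn_work (hu : IsWeakSolutionWith Ω ν f u₀ u U g)
    (hf : ∀ T : ℝ, 0 < T → MemLp f 2 (volume.restrict (Ioo 0 T))) {T : ℝ} (hT : 0 < T) :
    IntegrableOn (fun t => f t (U t)) (Ioo 0 T) :=
  memLp_one_iff_integrable.1 <|
    (ContinuousLinearMap.id ℝ (V' Ω)).memLp_of_bilin 1 (hf T hT) (hu.memL2 T hT)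

end WeakSolution

/-! ### The energy inequality in dimension two -/

section Planar

variable {Ω : Set (E 2)} {ν : ℝ → ℝ} {f : ℝ → V' Ω} {u₀ : H Ω} {u : ℝ → H Ω}
  {U : ℝ → V Ω} {g : ℝ → V' Ω}

/-- In dimension two, the time derivative of a weak solution is square integrable in time. -/
theorem IsWeakSolutionWith.memLp_timeDeriv (hu : IsWeakSolutionWith Ω ν f u₀ u U g)
    {νhigh : ℝ} (hν : ∀ t : ℝ, 0 < t → 0 ≤ ν t ∧ ν t ≤ νhigh)
    (hf : ∀ T : ℝ, 0 < T → MemLp f 2 (volume.restrict (Ioo 0 T))) {a b : ℝ} (ha : 0 < a)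
    (hab : a < b) : MemLp g 2 (volume.restrict (Icc a b)) := by
  obtain ⟨M, hM0, hM⟩ := hu.exists_norm_le b
  obtain ⟨C, hC0, hC⟩ := exists_abs_formB_self_le Ω
  have hb : 0 < b + 1 := by linarith
  have hle : volume.restrict (Icc a b) ≤ volume.restrict (Ioo 0 (b + 1)) :=
    Measure.restrict_mono (Icc_subset_Ioo ha (by linarith)) le_rfl
  have hf' := ((hf _ hb).mono_measure hle).norm
  have hU' := ((hu.memL2 _ hb).mono_measure hle).norm
  -- The equation bounds ‖g(t)‖ by this square integrable majorant: f, then the viscous term, then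
  -- the convective term with ‖u‖_H ≤ M.
  refine (hf'.add (hU'.const_mul (νhigh + C * M))).mono' (hu.derivL1 a b ha hab).1 ?_
  rw [ae_restrict_iff' measurableSet_Icc]
  have h1 := (ae_restrict_iff' measurableSet_Ioi).1 hu.weakForm
  have h2 := (ae_restrict_iff' measurableSet_Ioi).1 hu.coe_eq
  filter_upwards [h1, h2] with t h1 h2 ht
  have ht0 : 0 < t := ha.trans_le ht.1
  have hνt := hν t ht0
  have hu2 : ‖field (U t)‖ ≤ M := by
    rw [← h2 ht0]; exact hM t ⟨ht0.le, ht.2⟩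
  refine ContinuousLinearMap.opNorm_le_bound _ (by
    have : 0 ≤ νhigh := hνt.1.trans hνt.2
    simp only [Pi.add_apply]
    positivity) fun v => ?_
  have h3 := h1 ht0 v
  have h4 : g t v = f t v - ν t * formA (U t) v - formB (U t) (U t) v := by linarith
  have h5 : |formA (U t) v| ≤ ‖U t‖ * ‖v‖ := (abs_real_inner_le_norm _ _).trans
    (mul_le_mul (norm_grad_le _) (norm_grad_le _) (norm_nonneg _) (norm_nonneg _))
  have h6 : |formB (U t) (U t) v| ≤ C * M * ‖U t‖ * ‖v‖ := (hC (U t) v).trans (by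
    gcongr
    exact norm_grad_le _)
  have h7 : |ν t * formA (U t) v| ≤ νhigh * (‖U t‖ * ‖v‖) := by
    rw [abs_mul, abs_of_nonneg hνt.1]
    exact mul_le_mul hνt.2 h5 (abs_nonneg _) (hνt.1.trans hνt.2)
  have h8 : |f t v| ≤ ‖f t‖ * ‖v‖ := (f t).le_opNorm v
  rw [h4, Real.norm_eq_abs]
  refine (abs_sub _ _).trans ((add_le_add_left (abs_sub _ _) _).trans ?_)
  simp only [Pi.add_apply]
  linarith

/-- In dimension two, every weak solution satisfies the energy inequality. -/
theorem IsWeakSolutionWith.energy_planar (hu : IsWeakSolutionWith Ω ν f u₀ u U g)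
    {νhigh : ℝ} (hνL1 : ∀ T : ℝ, 0 < T → IntegrableOn ν (Ioo 0 T))
    (hν : ∀ t : ℝ, 0 < t → 0 ≤ ν t ∧ ν t ≤ νhigh)
    (hf : ∀ T : ℝ, 0 < T → MemLp f 2 (volume.restrict (Ioo 0 T))) :
    ∀ᵐ s, s ∈ Ioi (0 : ℝ) → ∀ t : ℝ, s ≤ t →
      (1 / 2 : ℝ) * ‖u t‖ ^ 2 + ∫ τ in s..t, ν τ * ‖grad (U τ)‖ ^ 2 ≤
        (1 / 2 : ℝ) * ‖u s‖ ^ 2 + ∫ τ in s..t, f τ (U τ) := by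
  have hcoe := (ae_restrict_iff' measurableSet_Ioi).1 hu.coe_eq
  have hform := (ae_restrict_iff' measurableSet_Ioi).1 hu.weakForm
  -- Countably many compact intervals [1/(n+2), n+2] exhaust (0, ∞), so one null set suffices; the
  -- shift by 2 keeps them nondegenerate at n = 0.
  have hloc : ∀ n : ℕ, ∀ᵐ s, s ∈ Ioo (1 / (n + 2 : ℝ)) (n + 2) → ∀ t ∈ Icc s (n + 2 : ℝ),
      ‖(u t : L2Vec Ω)‖ ^ 2 ≤ ‖(u s : L2Vec Ω)‖ ^ 2 + 2 * ∫ τ in s..t, g τ (U τ) := by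
    intro n
    have ha : 0 < 1 / (n + 2 : ℝ) := by positivity
    have hab : 1 / (n + 2 : ℝ) < n + 2 := by
      rw [div_lt_iff₀ (by positivity)]
      have : (0 : ℝ) ≤ n := n.cast_nonneg
      nlinarith
    have hle : volume.restrict (Icc (1 / (n + 2 : ℝ)) (n + 2)) ≤
        volume.restrict (Ioo 0 ((n + 2 : ℝ) + 1)) :=
      Measure.restrict_mono (Icc_subset_Ioo ha (by linarith)) le_rfl
    refine energy_inequality_of_evolution (u := fun t => (u t : L2Vec Ω)) (fieldL Ω)
      ((hu.memL2 _ (by positivity)).mono_measure hle) (hu.memLp_timeDeriv hν hf ha hab) ?_ ?_ ?_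
    · filter_upwards [hcoe] with t ht h'
      exact ht (ha.trans_le h'.1)
    · exact fun v s hs t ht => hu.inner_sub_inner_eq v (ha.trans_le hs.1) (ha.trans_le ht.1)
    · exact fun t _ => (hu.weakCont (u t)).mono fun x hx => ha.le.trans hx.1
  filter_upwards [ae_all_iff.2 hloc] with s hs hs0 t hst
  have hs0' : 0 < s := hs0
  obtain ⟨n, hn⟩ := exists_nat_gt (max t (1 / s))
  have hn1 : t < n := (le_max_left _ _).trans_lt hn
  have hn2 : 1 / s < n := (le_max_right _ _).trans_lt hn
  have hmem : s ∈ Ioo (1 / (n + 2 : ℝ)) (n + 2) := by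
    refine ⟨?_, by linarith⟩
    rw [div_lt_iff₀ hs0'] at hn2
    rw [div_lt_iff₀ (by positivity)]
    linarith
  have key := hs n hmem t ⟨hst, by linarith⟩
  have hvisc := intervalIntegrable_of_Ioo (fun T hT => hu.integrableOn_viscous hνL1 hν hT)
    hs0'.le (hs0'.le.trans hst)
  have hwork := intervalIntegrable_of_Ioo (fun T hT => hu.integrableOn_work hf hT)
    hs0'.le (hs0'.le.trans hst)
  -- Testing the equation with U(τ) is allowed because it holds for all v at almost every time; the
  -- convective term vanishes.
  have e : ∫ τ in s..t, g τ (U τ) =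
      (∫ τ in s..t, f τ (U τ)) - ∫ τ in s..t, ν τ * ‖grad (U τ)‖ ^ 2 := by
    rw [← intervalIntegral.integral_sub hwork hvisc]
    refine intervalIntegral.integral_congr_ae ?_
    filter_upwards [hform] with τ hτ hτI
    rw [uIoc_of_le hst] at hτI
    have h1 := hτ (hs0'.trans hτI.1) (U τ)
    rw [formB_self_self, formA, real_inner_self_eq_norm_sq] at h1
    linarith
  rw [e] at key
  change (1 / 2 : ℝ) * ‖(u t : L2Vec Ω)‖ ^ 2 + _ ≤ (1 / 2 : ℝ) * ‖(u s : L2Vec Ω)‖ ^ 2 + _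
  linarith

end Planar

/-! ### From the energy inequality to a damped inequality -/

section Dissipation

variable {d : ℕ} {Ω : Set (E d)} {ν : ℝ → ℝ} {f : ℝ → V' Ω} {u₀ : H Ω} {u : ℝ → H Ω}
  {U : ℝ → V Ω} {g : ℝ → V' Ω}

theorem IsWeakSolutionWith.energy_inequality (hu : IsWeakSolutionWith Ω ν f u₀ u U g)
    (hd : d = 2 ∨ d = 3) {νhigh : ℝ} (hνL1 : ∀ T : ℝ, 0 < T → IntegrableOn ν (Ioo 0 T))
    (hν : ∀ t : ℝ, 0 < t → 0 ≤ ν t ∧ ν t ≤ νhigh)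
    (hf : ∀ T : ℝ, 0 < T → MemLp f 2 (volume.restrict (Ioo 0 T))) :
    ∀ᵐ s, s ∈ Ioi (0 : ℝ) → ∀ t : ℝ, s ≤ t →
      (1 / 2 : ℝ) * ‖u t‖ ^ 2 + ∫ τ in s..t, ν τ * ‖grad (U τ)‖ ^ 2 ≤
        (1 / 2 : ℝ) * ‖u s‖ ^ 2 + ∫ τ in s..t, f τ (U τ) := by
  rcases hd with rfl | rfl
  · exact hu.energy_planar hνL1 hν hf
  · exact (ae_restrict_iff' measurableSet_Ioi).1 (hu.energy rfl)

/-- The damped integral inequality for the energy, once the force is bounded in `V'`. -/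
theorem IsWeakSolutionWith.damped_energy (hu : IsWeakSolutionWith Ω ν f u₀ u U g)
    (hd : d = 2 ∨ d = 3) (hΩb : Bornology.IsBounded Ω) (hc : 0 < poincareConst Ω)
    {νlow νhigh : ℝ} (hνL1 : ∀ T : ℝ, 0 < T → IntegrableOn ν (Ioo 0 T)) (hνlow : 0 < νlow)
    (hν : ∀ t : ℝ, 0 < t → νlow ≤ ν t ∧ ν t ≤ νhigh)
    (hf : ∀ T : ℝ, 0 < T → MemLp f 2 (volume.restrict (Ioo 0 T)))
    {A T₀ : ℝ} (hA : 0 ≤ A)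
    (hfA : ∀ᵐ t, T₀ ≤ t → dualNorm (f t) ^ 2 ≤ ENNReal.ofReal A) :
    (∀ T : ℝ, 0 < T → IntegrableOn (fun t => ν t / poincareConst Ω ^ 2 * ‖u t‖ ^ 2) (Ioo 0 T)) ∧
    ∀ᵐ s, s ∈ Ioi (0 : ℝ) → T₀ ≤ s → ∀ t : ℝ, s ≤ t →
      ‖u t‖ ^ 2 + (∫ τ in s..t, ν τ / poincareConst Ω ^ 2 * ‖u τ‖ ^ 2) - A / νlow * (t - s) ≤
        ‖u s‖ ^ 2 := by
  set c := poincareConst Ω with hcdef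
  have hν' : ∀ t : ℝ, 0 < t → 0 ≤ ν t ∧ ν t ≤ νhigh := fun t ht =>
    ⟨hνlow.le.trans (hν t ht).1, (hν t ht).2⟩
  have hcoe := (ae_restrict_iff' measurableSet_Ioi).1 hu.coe_eq
  have hint : ∀ T : ℝ, 0 < T → IntegrableOn (fun t => ν t / c ^ 2 * ‖u t‖ ^ 2) (Ioo 0 T) := by
    intro T hT
    have h1 : IntegrableOn (fun t => ‖field (U t)‖ ^ 2) (Ioo 0 T) :=
      ((fieldL Ω).comp_memLp' (hu.memL2 T hT)).integrable_norm_pow (by simp)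
    have h2 : IntegrableOn (fun t => ν t * ‖field (U t)‖ ^ 2) (Ioo 0 T) := by
      refine h1.bdd_mul (c := νhigh) (hνL1 T hT).1 ?_
      refine (ae_restrict_iff' measurableSet_Ioo).2 (.of_forall fun t ht => ?_)
      rw [Real.norm_of_nonneg (hν' t ht.1).1]
      exact (hν' t ht.1).2
    refine (h2.div_const (c ^ 2)).congr ?_
    rw [EventuallyEq, ae_restrict_iff' measurableSet_Ioo]
    filter_upwards [hcoe] with t ht htI
    rw [← ht htI.1, ← Submodule.coe_norm]
    ring
  refine ⟨hint, ?_⟩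
  filter_upwards [hu.energy_inequality hd hνL1 hν' hf] with s hs hs0 hTs t hst
  have hs0' : 0 < s := hs0
  have h0t : 0 ≤ t := hs0'.le.trans hst
  have key := hs hs0 t hst
  have hvisc := intervalIntegrable_of_Ioo (fun T hT => hu.integrableOn_viscous hνL1 hν' hT)
    hs0'.le h0t
  have hwork := intervalIntegrable_of_Ioo (fun T hT => hu.integrableOn_work hf hT) hs0'.le h0t
  have hdamp := intervalIntegrable_of_Ioo hint hs0'.le h0t
  -- Of the two copies of νx², x = ‖∇U‖, one absorbs the force by completing the square in √A - νx,
  -- and the other dominates (ν/c²)‖u‖² by Poincaré.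
  have hmono : ∫ τ in s..t, (2 * f τ (U τ) - 2 * (ν τ * ‖grad (U τ)‖ ^ 2)) ≤
      ∫ τ in s..t, (A / νlow - ν τ / c ^ 2 * ‖u τ‖ ^ 2) := by
    refine intervalIntegral.integral_mono_ae_restrict hst
      ((hwork.const_mul 2).sub (hvisc.const_mul 2)) (intervalIntegrable_const.sub hdamp) ?_
    refine (ae_restrict_iff' measurableSet_Icc).2 ?_
    filter_upwards [hcoe, hfA] with τ h1 h2 hτ
    have hτ0 : 0 < τ := hs0'.trans_le hτ.1
    have h3 := abs_apply_le_of_dualNorm_sq_le hd hΩb (h2 (hTs.trans hτ.1)) (U τ)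
    have h4 := norm_field_le_poincareConst hd hΩb (U τ)
    rw [← h1 hτ0, ← Submodule.coe_norm, ← hcdef] at h4
    obtain ⟨h5, -⟩ := hν τ hτ0
    have hντ : 0 < ν τ := hνlow.trans_le h5
    set x := ‖grad (U τ)‖
    have h6 : ‖u τ‖ ^ 2 ≤ c ^ 2 * x ^ 2 := by
      rw [← mul_pow]; exact pow_le_pow_left₀ (norm_nonneg _) h4 2
    have h7 : ν τ / c ^ 2 * ‖u τ‖ ^ 2 ≤ ν τ * x ^ 2 := by
      rw [div_mul_eq_mul_div, div_le_iff₀ (by positivity)]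
      nlinarith
    have h8 : 2 * (√A * x) ≤ A / ν τ + ν τ * x ^ 2 := by
      have e : A / ν τ + ν τ * x ^ 2 - 2 * (√A * x) = (√A - ν τ * x) ^ 2 / ν τ := by
        field_simp
        rw [sub_sq, Real.sq_sqrt hA]
        ring
      have : 0 ≤ (√A - ν τ * x) ^ 2 / ν τ := by positivity
      linarith
    have h9 : A / ν τ ≤ A / νlow := by gcongr
    have h10 := (le_abs_self _).trans h3
    change 2 * f τ (U τ) - 2 * (ν τ * x ^ 2) ≤ A / νlow - ν τ / c ^ 2 * ‖u τ‖ ^ 2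
    linarith
  rw [intervalIntegral.integral_sub (hwork.const_mul 2) (hvisc.const_mul 2),
    intervalIntegral.integral_sub intervalIntegrable_const hdamp,
    intervalIntegral.integral_const_mul, intervalIntegral.integral_const_mul,
    intervalIntegral.integral_const, smul_eq_mul] at hmono
  linarith

end Dissipation

/-! ### The exponential kernel and the size of K̄ -/

section Kernel

theorem integral_exp_decay {m t : ℝ} (hm : 0 < m) :
    ∫ s in (0 : ℝ)..t, Real.exp (-(m * (t - s))) = (1 - Real.exp (-(m * t))) / m := by
  have hd : ∀ s ∈ uIcc 0 t, HasDerivAt (fun s => Real.exp (-(m * (t - s))) / m)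
      (Real.exp (-(m * (t - s)))) s := by
    intro s _
    have h1 : HasDerivAt (fun s => -(m * (t - s))) m s := by
      simpa using! (((hasDerivAt_id s).const_sub t).const_mul m).neg
    have h2 := h1.exp.div_const m
    rwa [mul_div_cancel_right₀ _ hm.ne'] at h2
  rw [intervalIntegral.integral_eq_sub_of_hasDerivAt hd
    ((by fun_prop : Continuous fun s => Real.exp (-(m * (t - s)))).intervalIntegrable _ _)]
  simp [sub_div]

variable {ν : ℝ → ℝ} {νlow νhigh c : ℝ}

theorem intervalIntegrable_kernel (hνL1 : ∀ T : ℝ, 0 < T → IntegrableOn ν (Ioo 0 T)) (c : ℝ)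
    {p q t : ℝ} (hp : 0 ≤ p) (hpq : p ≤ q) (hqt : q ≤ t) :
    IntervalIntegrable (fun s => Real.exp (-(∫ z in s..t, ν z) / c ^ 2)) volume p q := by
  have h0t := hp.trans (hpq.trans hqt)
  have hi := intervalIntegrable_of_Ioo hνL1 le_rfl h0t
  have h1 := hi.absolutelyContinuousOnInterval_intervalIntegral right_mem_uIcc |>.continuousOn
  have h2 : ContinuousOn (fun s => ∫ z in s..t, ν z) (uIcc p q) := by
    refine (h1.neg.mono ?_).congr fun s _ => intervalIntegral.integral_symm _ _
    rw [uIcc_of_le hpq, uIcc_of_le h0t]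
    exact Icc_subset_Icc hp hqt
  exact (Real.continuous_exp.comp_continuousOn (h2.neg.div_const _)).intervalIntegrable

theorem integral_viscosity_bounds (hνL1 : ∀ T : ℝ, 0 < T → IntegrableOn ν (Ioo 0 T))
    (hν : ∀ t : ℝ, 0 < t → νlow ≤ ν t ∧ ν t ≤ νhigh) {s t : ℝ} (hs : 0 ≤ s) (hst : s ≤ t) :
    νlow * (t - s) ≤ ∫ z in s..t, ν z ∧ ∫ z in s..t, ν z ≤ νhigh * (t - s) := by
  have hi := intervalIntegrable_of_Ioo hνL1 hs (hs.trans hst)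
  have e : ∀ k : ℝ, k * (t - s) = ∫ _ in s..t, k := fun k => by
    rw [intervalIntegral.integral_const, smul_eq_mul, mul_comm]
  rw [e, e]
  refine ⟨intervalIntegral.integral_mono_on_of_le_Ioo hst (by simp) hi fun z hz => ?_,
    intervalIntegral.integral_mono_on_of_le_Ioo hst hi (by simp) fun z hz => ?_⟩
  exacts [(hν z (hs.trans_lt hz.1)).1, (hν z (hs.trans_lt hz.1)).2]

/-- The lower bound on ν bounds the integral by c²/νlow for every t ≥ 0. Finiteness is needed to let
the margin ε tend to zero at the end. -/
theorem Kbar_ne_top (hνL1 : ∀ T : ℝ, 0 < T → IntegrableOn ν (Ioo 0 T)) (hνlow : 0 < νlow)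
    (hν : ∀ t : ℝ, 0 < t → νlow ≤ ν t ∧ ν t ≤ νhigh) (hc : 0 < c) : Kbar ν c ≠ ⊤ := by
  have hm : 0 < νlow / c ^ 2 := by positivity
  refine ne_top_of_le_ne_top (ENNReal.ofReal_ne_top (r := 1 / (νlow / c ^ 2))) ?_
  refine limsup_le_of_le (by isBoundedDefault) ?_
  filter_upwards [eventually_ge_atTop 0] with t ht
  refine ENNReal.ofReal_le_ofReal ?_
  calc _ ≤ ∫ s in (0 : ℝ)..t, Real.exp (-(νlow / c ^ 2 * (t - s))) := by
        refine intervalIntegral.integral_mono_on ht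
          (intervalIntegrable_kernel hνL1 c le_rfl ht le_rfl)
          (Continuous.intervalIntegrable (by fun_prop) _ _) fun s hs => ?_
        rw [Real.exp_le_exp, neg_div, neg_le_neg_iff, div_mul_eq_mul_div]
        gcongr
        exact (integral_viscosity_bounds hνL1 hν hs.1 hs.2).1
    _ = (1 - Real.exp (-(νlow / c ^ 2 * t))) / (νlow / c ^ 2) := integral_exp_decay hm
    _ ≤ _ := by
        gcongr
        linarith [Real.exp_pos (-(νlow / c ^ 2 * t))]

/-- On the last unit interval [t - 1, t] the kernel is at least exp(-νhigh/c²). This excludes the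
product 0 · ∞ when the force has infinite limsup. -/
theorem Kbar_ne_zero (hνL1 : ∀ T : ℝ, 0 < T → IntegrableOn ν (Ioo 0 T))
    (hν : ∀ t : ℝ, 0 < t → νlow ≤ ν t ∧ ν t ≤ νhigh) (hνlow : 0 < νlow) : Kbar ν c ≠ 0 := by
  have hhigh : 0 < νhigh := hνlow.trans_le ((hν 1 one_pos).1.trans (hν 1 one_pos).2)
  have hpos : 0 < ENNReal.ofReal (Real.exp (-(νhigh / c ^ 2))) :=
    ENNReal.ofReal_pos.2 (Real.exp_pos _)
  refine (hpos.trans_le ?_).ne'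
  refine le_limsup_of_frequently_le (Eventually.frequently ?_) (by isBoundedDefault)
  filter_upwards [eventually_ge_atTop 1] with t ht
  refine ENNReal.ofReal_le_ofReal ?_
  have h1 : (0 : ℝ) ≤ t - 1 := by linarith
  have hi1 := intervalIntegrable_kernel hνL1 c le_rfl h1 (sub_le_self t zero_le_one)
  have hi2 := intervalIntegrable_kernel hνL1 c h1 (sub_le_self t zero_le_one) le_rfl
  rw [← intervalIntegral.integral_add_adjacent_intervals hi1 hi2]
  have e : Real.exp (-(νhigh / c ^ 2)) = ∫ _ in (t - 1)..t, Real.exp (-(νhigh / c ^ 2)) := by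
    rw [intervalIntegral.integral_const]; simp
  have h2 : Real.exp (-(νhigh / c ^ 2)) ≤
      ∫ s in (t - 1)..t, Real.exp (-(∫ z in s..t, ν z) / c ^ 2) := by
    rw [e]
    refine intervalIntegral.integral_mono_on (by linarith) (by simp) hi2 fun s hs => ?_
    rw [Real.exp_le_exp, neg_div, neg_le_neg_iff]
    gcongr
    refine (integral_viscosity_bounds hνL1 hν (h1.trans hs.1) hs.2).2.trans ?_
    nlinarith [hs.1]
  have h3 : 0 ≤ ∫ s in (0 : ℝ)..(t - 1), Real.exp (-(∫ z in s..t, ν z) / c ^ 2) :=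
    intervalIntegral.integral_nonneg h1 fun s _ => (Real.exp_pos _).le
  linarith

end Kernel

/-! ### Long-time behaviour and conclusion -/

section LongTime

variable {d : ℕ} {Ω : Set (E d)} {ν : ℝ → ℝ} {f : ℝ → V' Ω} {u₀ : H Ω} {u : ℝ → H Ω}
  {U : ℝ → V Ω} {g : ℝ → V' Ω}

/-- Every element of V then has zero field, so u vanishes almost everywhere, and weak continuity
extends this to every positive time. This covers degenerate cases such as empty Ω, where dividing by
the squared constant has no meaning. -/
theorem IsWeakSolutionWith.eq_zero_of_poincareConst_eq_zero
    (hu : IsWeakSolutionWith Ω ν f u₀ u U g) (hd : d = 2 ∨ d = 3)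
    (hΩb : Bornology.IsBounded Ω) (hc : poincareConst Ω = 0) {t : ℝ} (ht : 0 < t) : u t = 0 := by
  have hfield : ∀ v : V Ω, field v = 0 := fun v => by
    have := norm_field_le_poincareConst hd hΩb v
    rw [hc, zero_mul] at this
    exact norm_le_zero_iff.1 this
  have hzero : EqOn (fun τ => (inner ℝ (u τ) (u t) : ℝ)) (fun _ => 0) (Ioi 0) := by
    refine Measure.eqOn_open_of_ae_eq (μ := volume) ?_ isOpen_Ioi
      ((hu.weakCont (u t)).mono Ioi_subset_Ici_self) continuousOn_const
    filter_upwards [hu.coe_eq] with τ hτ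
    rw [hfield] at hτ
    have : u τ = 0 := Subtype.ext hτ
    simp [this]
  exact inner_self_eq_zero.1 (hzero ht)

/-- The asymptotic energy bound, once the force is bounded in `V'`. -/
theorem IsWeakSolutionWith.limsup_energy_le (hu : IsWeakSolutionWith Ω ν f u₀ u U g)
    (hd : d = 2 ∨ d = 3) (hΩb : Bornology.IsBounded Ω) (hc : 0 < poincareConst Ω)
    {νlow νhigh : ℝ} (hνL1 : ∀ T : ℝ, 0 < T → IntegrableOn ν (Ioo 0 T)) (hνlow : 0 < νlow)
    (hν : ∀ t : ℝ, 0 < t → νlow ≤ ν t ∧ ν t ≤ νhigh)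
    (hf : ∀ T : ℝ, 0 < T → MemLp f 2 (volume.restrict (Ioo 0 T)))
    {A : ℝ} (hA : 0 ≤ A)
    (hfA : ∀ᶠ t in atTop ⊓ ae volume, dualNorm (f t) ^ 2 ≤ ENNReal.ofReal A) :
    limsup (fun t : ℝ => ENNReal.ofReal (‖u t‖ ^ 2)) atTop ≤
      ENNReal.ofReal (A / νlow) * Kbar ν (poincareConst Ω) := by
  set c := poincareConst Ω with hcdef
  obtain ⟨S, hS, S', hS', hSS⟩ := mem_inf_iff.1 hfA
  obtain ⟨T₀, hT₀⟩ := mem_atTop_sets.1 hS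
  have hfA' : ∀ᵐ t, T₀ ≤ t → dualNorm (f t) ^ 2 ≤ ENNReal.ofReal A := by
    filter_upwards [hS'] with t ht hT
    have : t ∈ S ∩ S' := ⟨hT₀ t hT, ht⟩
    rwa [← hSS] at this
  obtain ⟨hint, hdamp⟩ := hu.damped_energy hd hΩb hc hνL1 hνlow hν hf hA hfA'
  rw [← hcdef] at hint hdamp
  -- Admissible starting times have full measure, so one lies beyond max(T₀, 0).
  obtain ⟨s, hsT, hs⟩ : ∃ s, s ∈ Ioi (max T₀ 0) ∧ ∀ t : ℝ, s ≤ t →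
      ‖u t‖ ^ 2 + (∫ τ in s..t, ν τ / c ^ 2 * ‖u τ‖ ^ 2) - A / νlow * (t - s) ≤ ‖u s‖ ^ 2 := by
    have h1 : ∀ᵐ s, s ∈ Ioi (max T₀ 0) → ∀ t : ℝ, s ≤ t →
      ‖u t‖ ^ 2 + (∫ τ in s..t, ν τ / c ^ 2 * ‖u τ‖ ^ 2) - A / νlow * (t - s) ≤ ‖u s‖ ^ 2 := by
      filter_upwards [hdamp] with s hs hsI
      exact hs (mem_Ioi.2 ((le_max_right _ _).trans_lt hsI)) ((le_max_left _ _).trans (le_of_lt hsI))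
    have h2 : ∃ᵐ s : ℝ, s ∈ Ioi (max T₀ 0) := by
      rw [frequently_ae_mem_iff]; simp
    obtain ⟨s, hs, hs'⟩ := (h2.and_eventually h1).exists
    exact ⟨s, hs, hs' hs⟩
  have hs0 : 0 < s := (le_max_right _ _).trans_lt hsT
  have hsT₀ : T₀ ≤ s := (le_max_left _ _).trans (le_of_lt hsT)
  have hm : 0 < νlow / c ^ 2 := by positivity
  set K : ℝ → ℝ := fun t => ∫ r in (0 : ℝ)..t, Real.exp (-(∫ z in r..t, ν z) / c ^ 2) with hK
  have hbound : ∀ t, s ≤ t →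
      ‖u t‖ ^ 2 ≤ Real.exp (-(νlow / c ^ 2 * (t - s))) * ‖u s‖ ^ 2 + A / νlow * K t := by
    intro t hst
    have h0t := hs0.le.trans hst
    have hker : ∀ r, ∫ τ in r..t, ν τ / c ^ 2 = (∫ τ in r..t, ν τ) / c ^ 2 := fun r =>
      intervalIntegral.integral_div _ _
    have hgr := damped_gronwall (y := fun t => ‖u t‖ ^ 2) (γ := fun t => ν t / c ^ 2)
      (A := A / νlow) hst ((intervalIntegrable_of_Ioo hνL1 hs0.le h0t).div_const _)
      (fun r hr => div_nonneg (hνlow.le.trans (hν r (hs0.trans_le hr.1)).1) (sq_nonneg c))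
      (intervalIntegrable_of_Ioo hint hs0.le h0t)
      (by
        filter_upwards [hdamp] with r hr hrI
        exact hr (hs0.trans_le hrI.1) (hsT₀.trans hrI.1) t hrI.2)
      (hs t hst)
    simp only [hker] at hgr
    refine hgr.trans ?_
    gcongr
    · rw [div_mul_eq_mul_div]
      gcongr
      exact (integral_viscosity_bounds hνL1 hν hs0.le hst).1
    -- Gronwall yields the kernel integral over (s, t) only; enlarging it to (0, t) adds a
    -- nonnegative term.
    · have e : K t = (∫ r in (0 : ℝ)..s, Real.exp (-(∫ z in r..t, ν z) / c ^ 2)) +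
          ∫ r in s..t, Real.exp (-(∫ z in r..t, ν z) / c ^ 2) :=
        (intervalIntegral.integral_add_adjacent_intervals
          (intervalIntegrable_kernel hνL1 c le_rfl hs0.le hst)
          (intervalIntegrable_kernel hνL1 c hs0.le hst le_rfl)).symm
      have h3 : 0 ≤ ∫ r in (0 : ℝ)..s, Real.exp (-(∫ z in r..t, ν z) / c ^ 2) :=
        intervalIntegral.integral_nonneg hs0.le fun r _ => (Real.exp_pos _).le
      rw [e]
      simp only [neg_div] at h3 ⊢
      linarith
  have hlim : Tendsto (fun t => ENNReal.ofReal
      (Real.exp (-(νlow / c ^ 2 * (t - s))) * ‖u s‖ ^ 2)) atTop (𝓝 0) := by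
    rw [← ENNReal.ofReal_zero]
    refine ENNReal.tendsto_ofReal ?_
    rw [← zero_mul (‖u s‖ ^ 2)]
    refine Tendsto.mul_const _ (Real.tendsto_exp_neg_atTop_nhds_zero.comp ?_)
    exact (tendsto_atTop_add_const_right _ (-s) tendsto_id).const_mul_atTop hm
  calc limsup (fun t : ℝ => ENNReal.ofReal (‖u t‖ ^ 2)) atTop
      ≤ limsup (fun t => ENNReal.ofReal (Real.exp (-(νlow / c ^ 2 * (t - s))) * ‖u s‖ ^ 2) +
          ENNReal.ofReal (A / νlow) * ENNReal.ofReal (K t)) atTop := by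
        refine limsup_le_limsup ?_ (by isBoundedDefault) (by isBoundedDefault)
        filter_upwards [eventually_ge_atTop s] with t ht
        refine (ENNReal.ofReal_le_ofReal (hbound t ht)).trans (ENNReal.ofReal_add_le.trans ?_)
        rw [ENNReal.ofReal_mul (p := A / νlow) (by positivity)]
    _ = ENNReal.ofReal (A / νlow) * Kbar ν c := by
        refine (ENNReal.limsup_add_of_left_tendsto_zero hlim _).trans ?_
        exact ENNReal.limsup_const_mul_of_ne_top ENNReal.ofReal_ne_top

end LongTime

end NSE

theorem lemma4p1 (d : ℕ) (hd : d = 2 ∨ d = 3) (Ω : Set (NSE.E d)) (hΩ : IsOpen Ω)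
    (hΩb : Bornology.IsBounded Ω)
    (ν : ℝ → ℝ) (νlow νhigh : ℝ) (hνL1 : ∀ T : ℝ, 0 < T → IntegrableOn ν (Set.Ioo 0 T))
    (hνlow : 0 < νlow) (hν : ∀ t : ℝ, 0 < t → νlow ≤ ν t ∧ ν t ≤ νhigh)
    (f : ℝ → NSE.V' Ω)
    (hf : ∀ T : ℝ, 0 < T → MemLp f 2 (volume.restrict (Set.Ioo 0 T)))
    (u₀ : NSE.H Ω) (u : ℝ → NSE.H Ω) (hu : NSE.IsWeakSolution Ω ν f u₀ u) :
    limsup (fun t : ℝ => ENNReal.ofReal (‖u t‖ ^ 2)) atTop ≤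
      NSE.Kbar ν (NSE.poincareConst Ω) / ENNReal.ofReal νlow *
        limsup (fun t : ℝ => NSE.dualNorm (f t) ^ 2) (atTop ⊓ ae volume) := by
  obtain ⟨U, g, hu⟩ := hu
  rcases NSE.poincareConst_nonneg.eq_or_lt with hc | hc
  · have h0 : limsup (fun t : ℝ => ENNReal.ofReal (‖u t‖ ^ 2)) atTop = 0 := by
      refine (Tendsto.congr' ?_ tendsto_const_nhds).limsup_eq
      filter_upwards [eventually_gt_atTop 0] with t ht
      simp [hu.eq_zero_of_poincareConst_eq_zero hd hΩb hc.symm ht]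
    rw [h0]
    exact zero_le
  have hK0 := NSE.Kbar_ne_zero (c := NSE.poincareConst Ω) hνL1 hν hνlow
  have hKtop := NSE.Kbar_ne_top hνL1 hνlow hν hc
  set L := limsup (fun t : ℝ => NSE.dualNorm (f t) ^ 2) (atTop ⊓ ae volume) with hL
  -- If L is infinite, so is the right side, because K̄/νlow is positive.
  rcases eq_or_ne L ⊤ with hLtop | hLtop
  · rw [hLtop, ENNReal.mul_top]
    · exact le_top
    · exact (ENNReal.div_pos hK0 ENNReal.ofReal_ne_top).ne'
  -- The margin ε makes L + ε an eventual almost everywhere bound of the force, which L itself need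
  -- not be.
  have hmain : ∀ ε : ℝ, 0 < ε → limsup (fun t : ℝ => ENNReal.ofReal (‖u t‖ ^ 2)) atTop ≤
      NSE.Kbar ν (NSE.poincareConst Ω) / ENNReal.ofReal νlow * (L + ENNReal.ofReal ε) := by
    intro ε hε
    have hlt : L < L + ENNReal.ofReal ε :=
      ENNReal.lt_add_right hLtop (ENNReal.ofReal_pos.2 hε).ne'
    have hev : ∀ᶠ t in atTop ⊓ ae volume,
        NSE.dualNorm (f t) ^ 2 ≤ ENNReal.ofReal (L.toReal + ε) := by
      filter_upwards [eventually_lt_of_limsup_lt (hL ▸ hlt)] with t ht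
      rw [ENNReal.ofReal_add ENNReal.toReal_nonneg hε.le, ENNReal.ofReal_toReal hLtop]
      exact ht.le
    refine (hu.limsup_energy_le hd hΩb hc hνL1 hνlow hν hf
      (add_nonneg ENNReal.toReal_nonneg hε.le) hev).trans_eq ?_
    rw [ENNReal.ofReal_div_of_pos hνlow, ENNReal.ofReal_add ENNReal.toReal_nonneg hε.le,
      ENNReal.ofReal_toReal hLtop, div_eq_mul_inv, div_eq_mul_inv]
    ring
  have hlim : Tendsto (fun ε : ℝ => NSE.Kbar ν (NSE.poincareConst Ω) / ENNReal.ofReal νlow *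
      (L + ENNReal.ofReal ε)) (𝓝[>] 0)
      (𝓝 (NSE.Kbar ν (NSE.poincareConst Ω) / ENNReal.ofReal νlow * L)) := by
    refine ENNReal.Tendsto.const_mul ?_ (Or.inr (ENNReal.div_ne_top hKtop
      (ENNReal.ofReal_pos.2 hνlow).ne'))
    have h1 : Tendsto (fun ε : ℝ => L + ENNReal.ofReal ε) (𝓝 0) (𝓝 (L + ENNReal.ofReal 0)) :=
      tendsto_const_nhds.add (ENNReal.continuous_ofReal.tendsto 0)
    rw [ENNReal.ofReal_zero, add_zero] at h1
    exact h1.mono_left nhdsWithin_le_nhds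
  refine ge_of_tendsto hlim ?_
  filter_upwards [self_mem_nhdsWithin] with ε hε
  exact hmain ε hε
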